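/- Let $X$ be a complex manifold of complex dimension $n$ and let $\Lambda$ be a holomorphic Poisson structure on $X$, i.e. a smooth section of $\wedge^2T^{1,0}X$ with $\bar\partial\Lambda=0$ and $[\Lambda,\Lambda]=0$ for the Schouten bracket. For $p,q\ge 0$ let $A^{p,q}$ be the space of smooth sections of $\wedge^pT^{1,0}X\otimes\wedge^qT^{*(0,1)}X$, put $\mathrm{ad}_\Lambda=[\Lambda,\cdot]:A^{p,q}\to A^{p+1,q}$, and let $K^m=\bigoplus_{p+q=m}A^{p,q}$ with total differential $D=\bar\partial+\mathrm{ad}_\Lambda$ be the total complex of the holomorphic Poisson double complex $(A^{p,q},\mathrm{ad}_\Lambda,\bar\partial)$. Let $(E_r^{p,q},d_r)$, $d_r:E_r^{p,q}\to E_r^{p+r,q-r+1}$, be the spectral sequence of the filtration $F^pK^m=\bigoplus_{p'\ge p}A^{p',m-p'}$, so that $E_0^{p,q}=A^{p,q}$ with $d_0=\bar\partial$ and $E_1^{p,q}=H^q(X,\wedge^p\Theta_X)$ with $d_1$ induced by $\mathrm{ad}_\Lambda$ (here $\Theta_X$ is the sheaf of holomorphic vector fields). Suppose that the Frölicher spectral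 sequence of $X$ degenerates at the $E_1$ level; this is the spectral sequence, for the filtration by the first degree $p$, of the double complex $(B^{p,q},\partial,\bar\partial)$ of smooth $(p,q)$-forms on $X$ with total differential $d=\partial+\bar\partial$. Then the spectral sequence of the holomorphic Poisson double complex degenerates at the $E_n$ level. Here a spectral sequence degenerates at the $E_N$ level if all its differentials $d_r$ with $r\ge N$ vanish. -/

import Mathlib

/-!
# The holomorphic Poisson double complex and its spectral sequence

A tensor field on a complex manifold is given by its expressions in all charts of the atlas, which
have to transform in the right way.  The local expressions are alternating forms on a fixed vector
space with smooth coefficients.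
-/
open scoped Manifold ContDiff

set_option maxHeartbeats 1000000
set_option maxSynthPendingDepth 6
set_option linter.unusedSectionVars false
set_option linter.unusedVariables false
set_option linter.unusedSimpArgs false

noncomputable section
namespace HolomorphicPoisson

/-! ### The spectral sequence of a filtered complex -/

section SpectralSequence

variable {K : ℕ → Type*} [∀ k, AddCommGroup (K k)] [∀ k, Module ℂ (K k)]

/-- `Z_r^p = F^p ∩ D⁻¹(F^{p+r})` in degree `k`. -/
def cycles (D : ∀ k, K k →ₗ[ℂ] K (k + 1)) (F : ℤ → ∀ k, Submodule ℂ (K k)) (r p : ℤ) (k : ℕ) :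
    Submodule ℂ (K k) :=
  F p k ⊓ (F (p + r) (k + 1)).comap (D k)

/-- `B_r^p = Z_{r-1}^{p+1} + D Z_{r-1}^{p-r+1}` in degree `k`. -/
def boundaries (D : ∀ k, K k →ₗ[ℂ] K (k + 1)) (F : ℤ → ∀ k, Submodule ℂ (K k)) (r p : ℤ) :
    ∀ k : ℕ, Submodule ℂ (K k)
  | 0 => cycles D F (r - 1) (p + 1) 0
  | k + 1 => cycles D F (r - 1) (p + 1) (k + 1) ⊔
      (cycles D F (r - 1) (p - r + 1) k).map (D k)

/-- The entry `E_r^{p,k-p} = Z_r^p / B_r^p` (in total degree `k`) of the spectral sequence of the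
filtered complex `(K, D, F)`. -/
abbrev Page (D : ∀ k, K k →ₗ[ℂ] K (k + 1)) (F : ℤ → ∀ k, Submodule ℂ (K k)) (r p : ℤ) (k : ℕ) :
    Type _ :=
  cycles D F r p k ⧸ (boundaries D F r p k).submoduleOf (cycles D F r p k)

theorem map_cycles {D : ∀ k, K k →ₗ[ℂ] K (k + 1)} (hD : ∀ k x, D (k + 1) (D k x) = 0)
    (F : ℤ → ∀ k, Submodule ℂ (K k)) (r p : ℤ) (k : ℕ) :
    ∀ x ∈ cycles D F r p k, D k x ∈ cycles D F r (p + r) (k + 1) := by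
  rintro x ⟨-, hx⟩
  refine ⟨hx, ?_⟩
  simp [hD]

theorem map_boundaries {D : ∀ k, K k →ₗ[ℂ] K (k + 1)} (hD : ∀ k x, D (k + 1) (D k x) = 0)
    (F : ℤ → ∀ k, Submodule ℂ (K k)) (r p : ℤ) (k : ℕ) :
    ∀ x ∈ boundaries D F r p k, D k x ∈ boundaries D F r (p + r) (k + 1) := by
  have key : ∀ x ∈ cycles D F (r - 1) (p + 1) k, D k x ∈ boundaries D F r (p + r) (k + 1) := by
    intro x hx
    refine Submodule.mem_sup_right ⟨x, ?_, rfl⟩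
    simpa using hx
  intro x hx
  cases k with
  | zero => exact key x hx
  | succ k =>
    obtain ⟨u, hu, _, ⟨v, -, rfl⟩, rfl⟩ := Submodule.mem_sup.1 hx
    rw [map_add, hD, add_zero]
    exact key u hu

/-- The differential `d_r : E_r^{p,q} → E_r^{p+r,q-r+1}`, where `k = p + q` is the total degree,
which `D` induces on the `r`-th page. -/
def pageDifferential {D : ∀ k, K k →ₗ[ℂ] K (k + 1)} (hD : ∀ k x, D (k + 1) (D k x) = 0)
    (F : ℤ → ∀ k, Submodule ℂ (K k)) (r p : ℤ) (k : ℕ) :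
    Page D F r p k →ₗ[ℂ] Page D F r (p + r) (k + 1) :=
  Submodule.mapQ _ _ ((D k).restrict (map_cycles hD F r p k))
    fun x hx ↦ map_boundaries hD F r p k x hx

/-- The spectral sequence of the filtered complex `(K, D, F)` degenerates at the `E_N` level:
the differentials `d_r` vanish for all `r ≥ N`. -/
def DegeneratesAt (D : ∀ k, K k →ₗ[ℂ] K (k + 1)) (hD : ∀ k x, D (k + 1) (D k x) = 0)
    (F : ℤ → ∀ k, Submodule ℂ (K k)) (N : ℕ) : Prop :=
  ∀ r : ℕ, N ≤ r → ∀ (p : ℤ) (k : ℕ), pageDifferential hD F r p k = 0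

end SpectralSequence

/-! Priorities of Mathlib instances and shortcuts, in order to make instance search faster. -/
attribute [local instance 2000] NormedSpace.toModule AddCommGroup.toAddCommMonoid
  SeminormedAddCommGroup.toAddCommGroup NormedAddCommGroup.toSeminormedAddCommGroup
  UniformSpace.toTopologicalSpace PseudoMetricSpace.toUniformSpace
  SeminormedAddCommGroup.toPseudoMetricSpace

section Shortcuts
variable {E F : Type*} [NormedAddCommGroup E] [NormedSpace ℂ E] [NormedAddCommGroup F]
  [NormedSpace ℂ F] {m n : ℕ}
instance (priority := 3000) homNormedAddCommGroup : NormedAddCommGroup (E →L[ℂ] F) :=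
  ContinuousLinearMap.toNormedAddCommGroup
instance (priority := 3000) homNormedSpace : NormedSpace ℂ (E →L[ℂ] F) :=
  ContinuousLinearMap.toNormedSpace
instance (priority := 3000) homNormedSpaceReal [NormedSpace ℝ F] [IsScalarTower ℝ ℂ F] :
    NormedSpace ℝ (E →L[ℂ] F) := ContinuousLinearMap.toNormedSpace
instance (priority := 3000) homIsScalarTower [NormedSpace ℝ F] [IsScalarTower ℝ ℂ F] :
    IsScalarTower ℝ ℂ (E →L[ℂ] F) := inferInstance
instance (priority := 3000) altNormedAddCommGroup : NormedAddCommGroup (E [⋀^Fin m]→L[ℂ] ℂ) :=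
  inferInstance
instance (priority := 3000) altNormedSpace : NormedSpace ℂ (E [⋀^Fin m]→L[ℂ] ℂ) := inferInstance
instance (priority := 3000) altNormedSpaceReal : NormedSpace ℝ (E [⋀^Fin m]→L[ℂ] ℂ) :=
  inferInstance
instance (priority := 3000) altIsScalarTower : IsScalarTower ℝ ℂ (E [⋀^Fin m]→L[ℂ] ℂ) :=
  inferInstance
instance (priority := 3000) prodNormedAddCommGroup : NormedAddCommGroup (E × F) :=
  Prod.normedAddCommGroup
instance (priority := 3000) prodNormedSpace : NormedSpace ℂ (E × F) := Prod.normedSpace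
instance (priority := 3000) coordNormedAddCommGroup : NormedAddCommGroup (Fin n → ℂ) :=
  Pi.normedAddCommGroup
instance (priority := 3000) coordNormedSpace : NormedSpace ℂ (Fin n → ℂ) := Pi.normedSpace
end Shortcuts

/-! ### Operators in coordinates -/

section LocalOperators
variable {n k : ℕ}

/-- The model space `ℂⁿ` of a complex manifold of dimension `n`. -/
abbrev Coord (n : ℕ) : Type := Fin n → ℂ

variable {F : Type*} [NormedAddCommGroup F] [NormedSpace ℂ F] [NormedSpace ℝ F]

/-- The Wirtinger derivative `∂g/∂z_j = ½ (∂g/∂x_j - i ∂g/∂y_j)`. -/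
def wirt (j : Fin n) (g : Coord n → F) (z : Coord n) : F :=
  (1 / 2 : ℂ) • (fderiv ℝ g z (Pi.single j 1) - Complex.I • fderiv ℝ g z (Pi.single j Complex.I))

/-- The Wirtinger derivative `∂g/∂z̄_j = ½ (∂g/∂x_j + i ∂g/∂y_j)`. -/
def wirtBar (j : Fin n) (g : Coord n → F) (z : Coord n) : F :=
  (1 / 2 : ℂ) • (fderiv ℝ g z (Pi.single j 1) + Complex.I • fderiv ℝ g z (Pi.single j Complex.I))

variable {W : Type*} [NormedAddCommGroup W] [NormedSpace ℂ W]

/-- The wedge product `α ∧ ψ` of a `1`-form and a `k`-form on `W`: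
`(α ∧ ψ)(v_0, …, v_k) = ∑ i, (-1)^i α(v_i) ψ(v_0, …, v_{i-1}, v_{i+1}, …, v_k)`. -/
def wedgeOne (α : W →L[ℂ] ℂ) (ψ : W [⋀^Fin k]→L[ℂ] ℂ) : W [⋀^Fin (k + 1)]→L[ℂ] ℂ :=
  ContinuousAlternatingMap.alternatizeUncurryFin (α.smulRight ψ)

variable {P : Type*} [NormedAddCommGroup P] [NormedSpace ℂ P]

/-- The form `dz̄_j`.  The second factor `Coord n` stands for `T^{0,1}`, and `w` there stands
for the vector `∑ j, w_j ∂/∂z̄_j`. -/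
def dzBar (j : Fin n) : P × Coord n →L[ℂ] ℂ :=
  (ContinuousLinearMap.proj j).comp (ContinuousLinearMap.snd ℂ P (Coord n))

/-- `∂̄ s = ∑ j, dz̄_j ∧ ∂s/∂z̄_j` -/
def dbarLocal (s : Coord n → (P × Coord n) [⋀^Fin k]→L[ℂ] ℂ) (z : Coord n) :
    (P × Coord n) [⋀^Fin (k + 1)]→L[ℂ] ℂ :=
  ∑ j, wedgeOne (dzBar j) (wirtBar j s z)

/-- The form `dz_j` on the complexified tangent space `T^{1,0} ⊕ T^{0,1}`, where `(v, w)` stands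
for `∑ j, (v_j ∂/∂z_j + w_j ∂/∂z̄_j)`. -/
def dz (j : Fin n) : Coord n × Coord n →L[ℂ] ℂ :=
  (ContinuousLinearMap.proj j).comp (ContinuousLinearMap.fst ℂ (Coord n) (Coord n))

/-- `∂ s = ∑ j, dz_j ∧ ∂s/∂z_j`, for differential forms -/
def delLocal (s : Coord n → (Coord n × Coord n) [⋀^Fin k]→L[ℂ] ℂ) (z : Coord n) :
    (Coord n × Coord n) [⋀^Fin (k + 1)]→L[ℂ] ℂ :=
  ∑ j, wedgeOne (dz j) (wirt j s z)

/-- The space `T^{*(1,0)} ⊕ T^{0,1}`.  The alternating `k`-forms on it are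
`⨁_{p+q=k} ∧^p T^{1,0} ⊗ ∧^q T^{*(0,1)}`. -/
abbrev Lbar (n : ℕ) : Type := (Coord n →L[ℂ] ℂ) × Coord n

/-- `dz_j` as an element of `T^{*(1,0)} ⊕ T^{0,1}` -/
def dzLbar (j : Fin n) : Lbar n := (ContinuousLinearMap.proj j, 0)

/-- The vector `∂/∂z_j` as a linear form on `T^{*(1,0)} ⊕ T^{0,1}` -/
def ddz (j : Fin n) : Lbar n →L[ℂ] ℂ :=
  (ContinuousLinearMap.apply ℂ ℂ (Pi.single j 1 : Coord n)).comp
    (ContinuousLinearMap.fst ℂ (Coord n →L[ℂ] ℂ) (Coord n))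

/-- The coefficient `Λ_{ij} = Λ(dz_i, dz_j)`, so that `Λ = ½ ∑ i j, Λ_{ij} ∂/∂z_i ∧ ∂/∂z_j` if
`Λ` is a section of `∧² T^{1,0}`. -/
def coeff (Λ : Coord n → Lbar n [⋀^Fin 2]→L[ℂ] ℂ) (i j : Fin n) (z : Coord n) : ℂ :=
  Λ z ![dzLbar i, dzLbar j]

/-- The Schouten bracket
`[Λ, Γ] = - ∑ l, (ι_{dz_l} Λ) ∧ ∂Γ/∂z_l - ∑ l, (∂Λ/∂z_l) ∧ ι_{dz_l} Γ`
of a bivector field `Λ` with a polyvector field `Γ` whose coefficients are forms in the `dz̄_j`.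
On functions it is `[X ∧ Y, f] = (Y f) X - (X f) Y`. -/
def schoutenLocal (Λ : Coord n → Lbar n [⋀^Fin 2]→L[ℂ] ℂ) :
    ∀ {k : ℕ}, (Coord n → Lbar n [⋀^Fin k]→L[ℂ] ℂ) → Coord n → Lbar n [⋀^Fin (k + 1)]→L[ℂ] ℂ
  | 0, s, z => -∑ i, ∑ j, coeff Λ i j z • wedgeOne (ddz j) (wirt i s z)
  | _ + 1, s, z => -∑ i, ∑ j, coeff Λ i j z • wedgeOne (ddz j) (wirt i s z) -
      (1 / 2 : ℂ) • ∑ l, ∑ i, ∑ j, wirt l (coeff Λ i j) z •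
        wedgeOne (ddz i) (wedgeOne (ddz j) ((s z).curryLeft (dzLbar l)))

/-- The complex conjugate `w ↦ conj (A (conj w))` of a linear map. -/
def conjL (A : Coord n →L[ℂ] Coord n) : Coord n →L[ℂ] Coord n where
  toFun w := star (A (star w))
  map_add' := by simp
  map_smul' := by simp
  cont := by fun_prop

end LocalOperators

/-! ### Tensor fields on a complex manifold -/

section TensorFields
variable {n : ℕ} {X : Type*} [TopologicalSpace X]

/-- The complex Jacobian, at the point with coordinates `z`, of the change of charts from `e` to
`e'`. -/
def jac (e e' : OpenPartialHomeomorph X (Coord n)) (z : Coord n) : Coord n →L[ℂ] Coord n :=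
  fderiv ℂ (e' ∘ e.symm) z

/-- The action of a change of charts on `T^{1,0} ⊕ T^{0,1}`. -/
def formFrame (e e' : OpenPartialHomeomorph X (Coord n)) (z : Coord n) :
    Coord n × Coord n →L[ℂ] Coord n × Coord n :=
  (jac e e' z).prodMap (conjL (jac e e' z))

/-- The action of a change of charts on `T^{*(1,0)} ⊕ T^{0,1}`: covectors `ξ` are pulled back by
the inverse change of charts. -/
def polyFrame (e e' : OpenPartialHomeomorph X (Coord n)) (z : Coord n) : Lbar n →L[ℂ] Lbar n :=
  ((ContinuousLinearMap.compL ℂ (Coord n) (Coord n) ℂ).flip (jac e' e (e' (e.symm z)))).prodMap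
    (conjL (jac e e' z))

/-- The smooth sections on `X` of the bundle of alternating `k`-forms on the vector bundle with
fibre `W` and transition functions `fr`, as families of local expressions `s e` in the charts
`e` of the atlas.  As the values of `s e` outside the target of `e` have no meaning, they are set to
`0`. -/
def sections {W : Type*} [NormedAddCommGroup W] [NormedSpace ℂ W]
    (X : Type*) [TopologicalSpace X] [ChartedSpace (Coord n) X]
    (fr : OpenPartialHomeomorph X (Coord n) → OpenPartialHomeomorph X (Coord n) →
      Coord n → W →L[ℂ] W) (k : ℕ) :
    Submodule ℂ (atlas (Coord n) X → Coord n → W [⋀^Fin k]→L[ℂ] ℂ) where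
  carrier := {s | (∀ e, ∀ z ∉ e.1.target, s e z = 0) ∧
    (∀ e, ContDiffOn ℝ ∞ (s e) e.1.target) ∧
    ∀ e e', ∀ z ∈ (e.1.symm.trans e'.1).source,
      s e z = (s e' (e'.1 (e.1.symm z))).compContinuousLinearMap (fr e e' z)}
  zero_mem' := ⟨fun _ _ _ ↦ rfl, fun _ ↦ contDiffOn_const, fun _ _ _ _ ↦ rfl⟩
  add_mem' := by
    rintro s t ⟨h1, h2, h3⟩ ⟨h1', h2', h3'⟩
    refine ⟨fun e z hz ↦ ?_, fun e ↦ (h2 e).add (h2' e), fun e e' z hz ↦ ?_⟩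
    · simp [h1 e z hz, h1' e z hz]
    · simp only [Pi.add_apply, h3 e e' z hz, h3' e e' z hz]
      rfl
  smul_mem' := by
    rintro a s ⟨h1, h2, h3⟩
    refine ⟨fun e z hz ↦ ?_, fun e ↦ (h2 e).const_smul a, fun e e' z hz ↦ ?_⟩
    · simp [h1 e z hz]
    · simp only [Pi.smul_apply, h3 e e' z hz]
      rfl

variable [ChartedSpace (Coord n) X]

/-- The sections of pure type `(p, k - p)`: they vanish on every `k`-tuple of vectors, each in
one of the two summands of `P × Coord n`, unless exactly `p` of them are in the first summand.
(This is the zero space for `p > k`.) -/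
def pureType {P : Type*} [NormedAddCommGroup P] [NormedSpace ℂ P]
    (fr : OpenPartialHomeomorph X (Coord n) → OpenPartialHomeomorph X (Coord n) →
      Coord n → P × Coord n →L[ℂ] P × Coord n) (p k : ℕ) : Submodule ℂ (sections X fr k) where
  carrier := {s | ∀ e z (S : Finset (Fin k)) (x : Fin k → P) (w : Fin k → Coord n), S.card ≠ p →
    s.1 e z (S.piecewise (fun i ↦ (x i, 0)) fun i ↦ (0, w i)) = 0}
  zero_mem' := fun _ _ _ _ _ _ ↦ rfl
  add_mem' := by
    intro s t hs ht e z S x w h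
    simp [hs e z S x w h, ht e z S x w h]
  smul_mem' := by
    intro a s hs e z S x w h
    simp [hs e z S x w h]

/-- The filtration by the first degree: `F^p` in degree `k` is the sum of the spaces of sections of
type `(p', k - p')` with `p' ≥ p`. -/
def filtration {P : Type*} [NormedAddCommGroup P] [NormedSpace ℂ P]
    (fr : OpenPartialHomeomorph X (Coord n) → OpenPartialHomeomorph X (Coord n) →
      Coord n → P × Coord n →L[ℂ] P × Coord n) (p : ℤ) (k : ℕ) : Submodule ℂ (sections X fr k) :=
  ⨆ (p' : ℕ) (_ : p ≤ p'), pureType fr p' k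

variable (n X) in
/-- The smooth complex differential `k`-forms `⨁_{p+q=k} B^{p,q}` on `X`. -/
abbrev Forms (k : ℕ) : Type _ := sections (n := n) X formFrame k

variable (n X) in
/-- The smooth sections of `⨁_{p+q=k} ∧^p T^{1,0} ⊗ ∧^q T^{*(0,1)}` on `X`, that is,
`⨁_{p+q=k} A^{p,q}`. -/
abbrev Polyvectors (k : ℕ) : Type _ := sections (n := n) X polyFrame k

end TensorFields

/-! ### Facts about the operators in coordinates

The operators above, and their sums, are of the form `connD R c` below, where `R` is the anchor and
`c` the bracket of coordinate sections of a Lie algebroid.  The facts about `connD R c` show that the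
operators do not depend on the chart and that the total differentials have square zero. -/

section Cplx
open Complex
variable {n k : ℕ} {F : Type*} [NormedAddCommGroup F] [NormedSpace ℂ F] [NormedSpace ℝ F]
  {W : Type*} [NormedAddCommGroup W] [NormedSpace ℂ W]
  {P : Type*} [NormedAddCommGroup P] [NormedSpace ℂ P]
variable [IsScalarTower ℝ ℂ F]

/-- The complex linear extension of a real linear map to `T^{1,0} ⊕ T^{0,1}`. -/
def cplx (L : Coord n →L[ℝ] F) : Coord n × Coord n →L[ℂ] F :=
  ∑ j, ((ContinuousLinearMap.proj j).comp (ContinuousLinearMap.fst ℂ (Coord n) (Coord n))).smulRight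
      ((1 / 2 : ℂ) • (L (Pi.single j 1) - I • L (Pi.single j I))) +
    ∑ j, ((ContinuousLinearMap.proj j).comp (ContinuousLinearMap.snd ℂ (Coord n) (Coord n))).smulRight
      ((1 / 2 : ℂ) • (L (Pi.single j 1) + I • L (Pi.single j I)))

theorem expand (L : Coord n →L[ℝ] F) (v : Coord n) :
    L v = ∑ j, ((v j).re • L (Pi.single j 1) + (v j).im • L (Pi.single j I)) := by
  conv_lhs => rw [← Finset.univ_sum_single v, map_sum]
  refine Finset.sum_congr rfl fun j _ ↦ ?_
  rw [← map_smul, ← map_smul, ← map_add]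
  congr 1
  rw [← Pi.single_smul, ← Pi.single_smul, ← Pi.single_add]
  congr 1
  simp [Complex.re_add_im]

theorem cplx_apply (L : Coord n →L[ℝ] F) (u : Coord n × Coord n) :
    cplx L u = (1 / 2 : ℂ) • (L u.1 - I • L (I • u.1)) +
      (1 / 2 : ℂ) • (L (star u.2) + I • L (I • star u.2)) := by
  rw [expand L u.1, expand L (I • u.1), expand L (star u.2), expand L (I • star u.2)]
  simp only [cplx, add_apply, sum_apply,
    ContinuousLinearMap.smulRight_apply, ContinuousLinearMap.comp_apply,
    ContinuousLinearMap.coe_fst', ContinuousLinearMap.coe_snd', ContinuousLinearMap.proj_apply,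
    Finset.smul_sum, ← Finset.sum_add_distrib, ← Finset.sum_sub_distrib]
  refine Finset.sum_congr rfl fun j _ ↦ ?_
  have h1 : u.1 j = ((u.1 j).re : ℂ) + (u.1 j).im * I := (Complex.re_add_im _).symm
  have h2 : u.2 j = ((u.2 j).re : ℂ) + (u.2 j).im * I := (Complex.re_add_im _).symm
  have h3 (r : ℝ) (x : F) : r • x = (r : ℂ) • x := by
    rw [← algebraMap_smul ℂ r x]; rfl
  simp only [Pi.smul_apply, Pi.star_apply, smul_eq_mul, I_mul_re, I_mul_im, RCLike.star_def,
    conj_re, conj_im, neg_neg, h3]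
  conv_lhs => rw [h1, h2]
  match_scalars
  · ring
  · ring_nf
    simp
    ring

@[simp] theorem conjL_apply (A : Coord n →L[ℂ] Coord n) (w : Coord n) :
    conjL A w = star (A (star w)) := rfl

theorem cplx_add (L L' : Coord n →L[ℝ] F) : cplx (L + L') = cplx L + cplx L' := by
  refine ContinuousLinearMap.ext fun u ↦ ?_
  simp only [cplx_apply, add_apply]
  module

variable {F' : Type*} [NormedAddCommGroup F'] [NormedSpace ℂ F'] [NormedSpace ℝ F']
  [IsScalarTower ℝ ℂ F']

theorem cplx_comp (M : F →L[ℂ] F') (L : Coord n →L[ℝ] F) :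
    cplx ((M.restrictScalars ℝ).comp L) = M.comp (cplx L) := by
  refine ContinuousLinearMap.ext fun u ↦ ?_
  simp [cplx_apply]

theorem cplx_comp_holo (L : Coord n →L[ℝ] F) (A : Coord n →L[ℂ] Coord n) :
    cplx (L.comp (A.restrictScalars ℝ)) = (cplx L).comp (A.prodMap (conjL A)) := by
  refine ContinuousLinearMap.ext fun u ↦ ?_
  simp [cplx_apply]

/-- `cplx` as a continuous linear map -/
def cplxL : (Coord n →L[ℝ] F) →L[ℝ] (Coord n × Coord n →L[ℂ] F) where
  toFun := cplx
  map_add' := cplx_add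
  map_smul' c L := by
    refine ContinuousLinearMap.ext fun u ↦ ?_
    simp only [cplx_apply, smul_apply, RingHom.id_apply, smul_comm c, smul_add, smul_sub]
  cont := by
    unfold cplx
    fun_prop

theorem cplx_cplx_symm {L : Coord n →L[ℝ] Coord n →L[ℝ] F} (hL : ∀ x y, L x y = L y x)
    (u v : Coord n × Coord n) : cplx (cplxL.comp L) u v = cplx (cplxL.comp L) v u := by
  simp only [cplx_apply, cplxL, ContinuousLinearMap.comp_apply, ContinuousLinearMap.coe_mk',
    LinearMap.coe_mk, AddHom.coe_mk, add_apply, sub_apply, smul_apply, hL v.1, hL (I • v.1), hL (star v.2), hL (I • star v.2)]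
  module

variable {W' : Type*} [NormedAddCommGroup W'] [NormedSpace ℂ W']

/-- The antisymmetrization of `a ↦ ∂_{R a} s - ½ c(a, ·) s`. -/
def connD (R : W →L[ℂ] Coord n × Coord n) (c : W →L[ℂ] W →L[ℂ] W)
    (s : Coord n → W [⋀^Fin k]→L[ℂ] ℂ) (z : Coord n) : W [⋀^Fin (k + 1)]→L[ℂ] ℂ :=
  ContinuousAlternatingMap.alternatizeUncurryFin ((cplx (fderiv ℝ s z)).comp R -
    (1 / 2 : ℂ) • ((s z).fderivCompContinuousLinearMap (.id ℂ W)).comp c)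

theorem alt_swap (σ : W' [⋀^Fin k]→L[ℂ] ℂ) (T : W →L[ℂ] W') (M : W →L[ℂ] W) :
    (σ.compContinuousLinearMap T).fderivCompContinuousLinearMap (.id ℂ W) M =
      σ.fderivCompContinuousLinearMap T (T.comp M) := by
  ext v
  simp only [ContinuousAlternatingMap.fderivCompContinuousLinearMap_apply,
    ContinuousAlternatingMap.compContinuousLinearMap_apply]
  refine Finset.sum_congr rfl fun i _ ↦ congrArg σ (funext fun j ↦ ?_)
  obtain rfl | h := eq_or_ne j i <;> simp [*]

theorem alt_swap' (σ : W' [⋀^Fin k]→L[ℂ] ℂ) (T : W →L[ℂ] W') (M : W' →L[ℂ] W') :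
    (σ.fderivCompContinuousLinearMap (.id ℂ W') M).compContinuousLinearMap T =
      σ.fderivCompContinuousLinearMap T (M.comp T) := by
  ext v
  simp only [ContinuousAlternatingMap.fderivCompContinuousLinearMap_apply,
    ContinuousAlternatingMap.compContinuousLinearMap_apply]
  refine Finset.sum_congr rfl fun i _ ↦ congrArg σ (funext fun j ↦ ?_)
  obtain rfl | h := eq_or_ne j i <;> simp [*]

theorem connD_pullback {f : Coord n → Coord n} {T : Coord n → W →L[ℂ] W'} {z : Coord n}
    {σ : Coord n → W' [⋀^Fin k]→L[ℂ] ℂ}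
    (hσ : DifferentiableAt ℝ σ (f z)) (hf : DifferentiableAt ℂ f z) (hT : DifferentiableAt ℝ T z)
    {R : W →L[ℂ] Coord n × Coord n} {R' : W' →L[ℂ] Coord n × Coord n}
    {c : W →L[ℂ] W →L[ℂ] W} {c' : W' →L[ℂ] W' →L[ℂ] W'}
    (hR : ∀ a, R' (T z a) = (fderiv ℂ f z).prodMap (conjL (fderiv ℂ f z)) (R a))
    (hc : ∀ a b, c a b = - c b a) (hc' : ∀ a b, c' a b = - c' b a)
    (hT' : ∀ a b, cplx (fderiv ℝ T z) (R a) b - cplx (fderiv ℝ T z) (R b) a =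
      T z (c a b) - c' (T z a) (T z b)) :
    connD R c (fun y ↦ (σ (f y)).compContinuousLinearMap (T y)) z =
      (connD R' c' σ (f z)).compContinuousLinearMap (T z) := by
  have h1 : fderiv ℝ (fun y ↦ (σ (f y)).compContinuousLinearMap (T y)) z =
      ((ContinuousAlternatingMap.compContinuousLinearMapCLM (T z)).restrictScalars ℝ).comp
        ((fderiv ℝ σ (f z)).comp ((fderiv ℂ f z).restrictScalars ℝ)) +
      (((σ (f z)).fderivCompContinuousLinearMap (T z)).restrictScalars ℝ).comp (fderiv ℝ T z) := by
    have := (ContinuousAlternatingMap.hasStrictFDerivAt_compContinuousLinearMap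
      (σ (f z), T z)).hasFDerivAt.restrictScalars ℝ
    have h2 := this.comp z ((hσ.hasFDerivAt.comp z (hf.hasFDerivAt.restrictScalars ℝ)).prodMk
      hT.hasFDerivAt)
    exact h2.fderiv
  have h0 := ContinuousAlternatingMap.alternatizeUncurryFin_fderivCompContinuousLinearMap_eq_zero
    (σ (f z)) (T z) (h := (cplx (fderiv ℝ T z)).comp R -
      (1 / 2 : ℂ) • ((ContinuousLinearMap.compL ℂ W W W' (T z)).comp c) + (1 / 2 : ℂ) •
        (((ContinuousLinearMap.compL ℂ W W' W').flip (T z)).comp (c'.comp (T z))))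
    (by
      intro a b
      have := hT' a b
      simp only [add_apply, sub_apply, smul_apply, ContinuousLinearMap.comp_apply,
        ContinuousLinearMap.compL_apply, ContinuousLinearMap.flip_apply]
      rw [hc b a, hc' _ (T z a), map_neg]
      rw [← sub_eq_zero] at this ⊢
      rw [← this]
      module)
  rw [connD, connD, h1, cplx_add, cplx_comp, cplx_comp, cplx_comp_holo]
  rw [← sub_eq_zero, ← h0]
  ext v
  simp only [ContinuousAlternatingMap.sub_apply,
    ContinuousAlternatingMap.compContinuousLinearMap_apply,
    ContinuousAlternatingMap.alternatizeUncurryFin_apply, ← Finset.sum_sub_distrib]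
  refine Finset.sum_congr rfl fun i _ ↦ ?_
  simp only [← smul_sub]
  congr 1
  simp only [add_apply, sub_apply, smul_apply, ContinuousLinearMap.comp_apply, alt_swap,
        ContinuousLinearMap.compL_apply, ContinuousLinearMap.flip_apply, map_add, map_sub, map_smul,
        ContinuousAlternatingMap.sub_apply, ContinuousAlternatingMap.add_apply,
        ContinuousAlternatingMap.smul_apply, Function.comp_apply, hR, ← alt_swap',
        ContinuousAlternatingMap.compContinuousLinearMap_apply, ContinuousAlternatingMap.compContinuousLinearMapCLM_apply]
  have hr : i.removeNth (T z ∘ v) = T z ∘ i.removeNth v := rfl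
  rw [← hr]
  ring

open ContinuousAlternatingMap in
theorem alt_three {m : ℕ} (f : W →L[ℂ] W →L[ℂ] W →L[ℂ] W [⋀^Fin m]→L[ℂ] ℂ)
    (hf : ∀ a b d, f a b d + f b d a + f d a b = f b a d + f a d b + f d b a) :
    alternatizeUncurryFin ((alternatizeUncurryFinCLM ℂ W ℂ).comp
      (((alternatizeUncurryFinCLM ℂ W ℂ).postcomp W).comp f)) = 0 := by
  set A : (W →L[ℂ] W →L[ℂ] W →L[ℂ] W [⋀^Fin m]→L[ℂ] ℂ) → W [⋀^Fin (m + 1 + 1 + 1)]→L[ℂ] ℂ :=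
    fun f ↦ alternatizeUncurryFin ((alternatizeUncurryFinCLM ℂ W ℂ).comp
      (((alternatizeUncurryFinCLM ℂ W ℂ).postcomp W).comp f)) with hA
  have hadd (f g) : A (f + g) = A f + A g := by
    simp only [hA, ContinuousLinearMap.comp_add, alternatizeUncurryFin_add]
  have h12 (f) : A f.flip = - A f := by
    rw [eq_neg_iff_add_eq_zero, ← hadd]
    refine alternatizeUncurryFin_alternatizeUncurryFinCLM_comp_of_symmetric fun x y ↦ ?_
    exact congrArg (alternatizeUncurryFinCLM ℂ W ℂ) (add_comm (f y x) (f x y))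
  let sw := (ContinuousLinearMap.flipₗᵢ ℂ W W (W [⋀^Fin m]→L[ℂ] ℂ)).toLinearIsometry.toContinuousLinearMap
  have hsw (f : W →L[ℂ] W →L[ℂ] W →L[ℂ] W [⋀^Fin m]→L[ℂ] ℂ) (a b d) :
    (sw.comp f) a b d = f a d b := rfl
  have h23 (f) : A (sw.comp f) = - A f := by
    rw [eq_neg_iff_add_eq_zero, ← hadd]
    have : (alternatizeUncurryFinCLM ℂ W ℂ).comp
      (((alternatizeUncurryFinCLM ℂ W ℂ).postcomp W).comp (sw.comp f + f)) = 0 := by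
      refine ContinuousLinearMap.ext fun a ↦ ?_
      refine alternatizeUncurryFin_alternatizeUncurryFinCLM_comp_of_symmetric fun x y ↦ ?_
      exact add_comm (f a y x) (f a x y)
    simp only [hA]
    rw [this]
    exact map_zero (alternatizeUncurryFinCLM ℂ W ℂ)
  have h0 : f + (sw.comp f).flip + sw.comp f.flip = f.flip + sw.comp f + sw.comp (sw.comp f).flip := by
    refine ContinuousLinearMap.ext fun a ↦ ContinuousLinearMap.ext fun b ↦
      ContinuousLinearMap.ext fun d ↦ ?_
    have := hf a b d
    change f a b d + f b d a + f d a b = f b a d + f a d b + f d b a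
    exact this
  have h1 := congrArg A h0
  simp only [hadd, h12, h23] at h1
  have h2 : (6 : ℂ) • A f = 0 := by
    rw [← sub_eq_zero] at h1
    rw [← h1]
    module
  simpa using h2

open ContinuousAlternatingMap in
/-- The derivation of alternating forms given by an endomorphism of `W`. -/
def actL : (W [⋀^Fin k]→L[ℂ] ℂ) →L[ℂ] (W →L[ℂ] W) →L[ℂ] W [⋀^Fin k]→L[ℂ] ℂ :=
  fderivCompContinuousLinearMapCLM ℂ (.id ℂ W)

theorem actL_apply (σ : W [⋀^Fin k]→L[ℂ] ℂ) (M : W →L[ℂ] W) (v : Fin k → W) :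
    actL σ M v = ∑ i, σ (Function.update v i (M (v i))) := by
  have : actL σ M v = σ.fderivCompContinuousLinearMap (.id ℂ W) M v := rfl
  rw [this, ContinuousAlternatingMap.fderivCompContinuousLinearMap_apply]
  refine Finset.sum_congr rfl fun i _ ↦ congrArg σ (funext fun j ↦ ?_)
  obtain rfl | h := eq_or_ne j i <;> simp [*]

theorem connD_eq (R : W →L[ℂ] Coord n × Coord n) (c : W →L[ℂ] W →L[ℂ] W)
    (s : Coord n → W [⋀^Fin k]→L[ℂ] ℂ) (z : Coord n) : connD R c s z =
  ContinuousAlternatingMap.alternatizeUncurryFin ((cplx (fderiv ℝ s z)).comp R -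
    (1 / 2 : ℂ) • (actL (s z)).comp c) := rfl

theorem actL_comm (σ : W [⋀^Fin k]→L[ℂ] ℂ) (M N : W →L[ℂ] W) :
    actL (actL σ N) M - actL σ (N.comp M) = actL (actL σ M) N - actL σ (M.comp N) := by
  have key (M N : W →L[ℂ] W) (v : Fin k → W) : actL (actL σ N) M v - actL σ (N.comp M) v =
      ∑ i, ∑ j, if i = j then 0 else
        σ (Function.update (Function.update v i (M (v i))) j (N (v j))) := by
    simp only [actL_apply, ← Finset.sum_sub_distrib]
    refine Finset.sum_congr rfl fun i _ ↦ ?_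
    rw [← Finset.add_sum_erase _ _ (Finset.mem_univ i), ← Finset.add_sum_erase _ _ (Finset.mem_univ i)]
    simp only [Function.update_self, Function.update_idem, ContinuousLinearMap.comp_apply, if_true, zero_add,
      add_sub_cancel_left]
    refine Finset.sum_congr rfl fun j hj ↦ ?_
    have : j ≠ i := by simpa using hj
    simp [this, this.symm]
  ext v
  simp only [ContinuousAlternatingMap.sub_apply, key]
  rw [Finset.sum_comm]
  refine Finset.sum_congr rfl fun i _ ↦ Finset.sum_congr rfl fun j _ ↦ ?_
  by_cases h : i = j
  · simp [h]
  · simp only [h, Ne.symm h, if_false]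
    rw [Function.update_comm (Ne.symm h)]

open ContinuousAlternatingMap in
theorem actL_alt (Φ : W →L[ℂ] W [⋀^Fin k]→L[ℂ] ℂ) (M : W →L[ℂ] W) :
    actL (alternatizeUncurryFin Φ) M =
      alternatizeUncurryFin ((actL.flip M).comp Φ + Φ.comp M) := by
  ext v
  simp only [actL_apply, alternatizeUncurryFin_apply]
  rw [Finset.sum_comm]
  refine Finset.sum_congr rfl fun i _ ↦ ?_
  rw [← Finset.smul_sum]
  congr 1
  rw [Fin.sum_univ_succAbove _ i]
  simp only [_root_.add_apply, ContinuousAlternatingMap.add_apply, ContinuousLinearMap.comp_apply,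
    ContinuousLinearMap.flip_apply, actL_apply, Function.update_self, Fin.removeNth_update]
  rw [add_comm]
  congr 1
  refine Finset.sum_congr rfl fun j _ ↦ ?_
  rw [Function.update_of_ne (Fin.succAbove_ne i j).symm]
  congr 1
  simp [Fin.removeNth_update_succAbove, Fin.removeNth]

theorem cplx_bilin {F₁ F₂ G : Type*} [NormedAddCommGroup F₁] [NormedSpace ℂ F₁] [NormedSpace ℝ F₁]
    [IsScalarTower ℝ ℂ F₁] [NormedAddCommGroup F₂] [NormedSpace ℂ F₂] [NormedSpace ℝ F₂]
    [IsScalarTower ℝ ℂ F₂] [NormedAddCommGroup G] [NormedSpace ℂ G] [NormedSpace ℝ G]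
    [IsScalarTower ℝ ℂ G] (B : F₁ →L[ℂ] F₂ →L[ℂ] G) {g₁ : Coord n → F₁} {g₂ : Coord n → F₂}
    {z : Coord n} (h₁ : DifferentiableAt ℝ g₁ z) (h₂ : DifferentiableAt ℝ g₂ z) :
    DifferentiableAt ℝ (fun y ↦ B (g₁ y) (g₂ y)) z ∧
    ∀ u, cplx (fderiv ℝ (fun y ↦ B (g₁ y) (g₂ y)) z) u =
      B (cplx (fderiv ℝ g₁ z) u) (g₂ z) + B (g₁ z) (cplx (fderiv ℝ g₂ z) u) := by
  have h := ((B.isBoundedBilinearMap.hasFDerivAt (g₁ z, g₂ z)).restrictScalars ℝ).comp z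
    (h₁.hasFDerivAt.prodMk h₂.hasFDerivAt)
  refine ⟨h.differentiableAt, fun u ↦ ?_⟩
  have h' : fderiv ℝ (fun y ↦ B (g₁ y) (g₂ y)) z =
    ((B.flip (g₂ z)).restrictScalars ℝ).comp (fderiv ℝ g₁ z) +
    ((B (g₁ z)).restrictScalars ℝ).comp (fderiv ℝ g₂ z) := by
    refine h.fderiv.trans ?_
    refine ContinuousLinearMap.ext fun u ↦ ?_
    simp [add_comm]
  rw [h', cplx_add, cplx_comp, cplx_comp]
  rfl

theorem cplx_linear {F₁ G : Type*} [NormedAddCommGroup F₁] [NormedSpace ℂ F₁] [NormedSpace ℝ F₁]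
    [IsScalarTower ℝ ℂ F₁] [NormedAddCommGroup G] [NormedSpace ℂ G] [NormedSpace ℝ G]
    [IsScalarTower ℝ ℂ G] (B : F₁ →L[ℂ] G) {g₁ : Coord n → F₁}
    {z : Coord n} (h₁ : DifferentiableAt ℝ g₁ z) :
    cplx (fderiv ℝ (fun y ↦ B (g₁ y)) z) = B.comp (cplx (fderiv ℝ g₁ z)) := by
  have h := (B.restrictScalars ℝ).hasFDerivAt.comp z h₁.hasFDerivAt
  rw [← cplx_comp]
  congr 1
  exact h.fderiv

open ContinuousAlternatingMap in
theorem alt_alt_congr {H G : W →L[ℂ] W →L[ℂ] W [⋀^Fin k]→L[ℂ] ℂ}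
    (h : ∀ a b, H a b - H b a = G a b - G b a) :
    alternatizeUncurryFin ((alternatizeUncurryFinCLM ℂ W ℂ).comp H) =
      alternatizeUncurryFin ((alternatizeUncurryFinCLM ℂ W ℂ).comp G) := by
  have := alternatizeUncurryFin_alternatizeUncurryFinCLM_comp_of_symmetric (f := H - G)
    (fun a b ↦ by
      have := h a b
      change H a b - G a b = H b a - G b a
      rw [sub_eq_sub_iff_add_eq_add] at this ⊢
      rw [this]; abel)
  rw [ContinuousLinearMap.comp_sub] at this
  have h2 : alternatizeUncurryFinCLM ℂ W ℂ ((alternatizeUncurryFinCLM ℂ W ℂ).comp H - (alternatizeUncurryFinCLM ℂ W ℂ).comp G) = 0 := this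
  rw [map_sub, sub_eq_zero] at h2
  exact h2

theorem cplx_sub_smul {g₁ g₂ : Coord n → F} {z : Coord n} (h₁ : DifferentiableAt ℝ g₁ z)
    (h₂ : DifferentiableAt ℝ g₂ z) (a : ℂ) : DifferentiableAt ℝ (fun y ↦ g₁ y - a • g₂ y) z ∧
    cplx (fderiv ℝ (fun y ↦ g₁ y - a • g₂ y) z) =
      cplx (fderiv ℝ g₁ z) - a • cplx (fderiv ℝ g₂ z) := by
  have h := h₁.hasFDerivAt.sub (h₂.hasFDerivAt.fun_const_smul a)
  refine ⟨h.differentiableAt, ?_⟩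
  have e : fderiv ℝ (fun y ↦ g₁ y - a • g₂ y) z = fderiv ℝ g₁ z - a • fderiv ℝ g₂ z := h.fderiv
  rw [e]
  refine ContinuousLinearMap.ext fun u ↦ ?_
  simp only [cplx_apply, _root_.sub_apply, _root_.smul_apply]
  module

def nabla (R : W →L[ℂ] Coord n × Coord n) (c : W →L[ℂ] W →L[ℂ] W)
    (s : Coord n → W [⋀^Fin k]→L[ℂ] ℂ) (z : Coord n) : W →L[ℂ] W [⋀^Fin k]→L[ℂ] ℂ :=
  ContinuousLinearMap.compL ℂ W _ _ (cplx (fderiv ℝ s z)) R -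
      (1 / 2 : ℂ) • ContinuousLinearMap.compL ℂ W _ _ (actL (s z)) c

theorem nabla_apply (R : W →L[ℂ] Coord n × Coord n) (c : W →L[ℂ] W →L[ℂ] W)
    (s : Coord n → W [⋀^Fin k]→L[ℂ] ℂ) (z : Coord n) (b : W) :
    nabla R c s z b = cplx (fderiv ℝ s z) (R b) - (1 / 2 : ℂ) • actL (s z) (c b) := rfl

theorem connD_nabla (R : W →L[ℂ] Coord n × Coord n) (c : W →L[ℂ] W →L[ℂ] W)
    (s : Coord n → W [⋀^Fin k]→L[ℂ] ℂ) (z : Coord n) :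
    connD R c s z = ContinuousAlternatingMap.alternatizeUncurryFinCLM ℂ W ℂ (nabla R c s z) := rfl

theorem cplx_nabla {R : Coord n → W →L[ℂ] Coord n × Coord n} {c : Coord n → W →L[ℂ] W →L[ℂ] W}
    {s : Coord n → W [⋀^Fin k]→L[ℂ] ℂ} {z : Coord n} (hs : ContDiffAt ℝ ∞ s z)
    (hR : DifferentiableAt ℝ R z) (hc : DifferentiableAt ℝ c z) :
    DifferentiableAt ℝ (fun y ↦ nabla (R y) (c y) s y) z ∧
    ∀ u b, cplx (fderiv ℝ (fun y ↦ nabla (R y) (c y) s y) z) u b =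
      cplx (cplxL.comp (fderiv ℝ (fderiv ℝ s) z)) u (R z b) +
      cplx (fderiv ℝ s z) (cplx (fderiv ℝ R z) u b) -
      (1 / 2 : ℂ) • (actL (cplx (fderiv ℝ s z) u) (c z b)  +
        actL (s z) (cplx (fderiv ℝ c z) u b)) := by
  have hds : DifferentiableAt ℝ s z := hs.differentiableAt (by simp)
  have hdds : DifferentiableAt ℝ (fderiv ℝ s) z :=
    (hs.fderiv_right (m := 1) (by norm_cast)).differentiableAt (by simp)
  have hcs0 := (cplxL (n := n) (F := W [⋀^Fin k]→L[ℂ] ℂ)).hasFDerivAt.comp z hdds.hasFDerivAt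
  have hcs : DifferentiableAt ℝ (fun y ↦ cplx (fderiv ℝ s y)) z := hcs0.differentiableAt
  have hcs' : fderiv ℝ (fun y ↦ cplx (fderiv ℝ s y)) z = cplxL.comp (fderiv ℝ (fderiv ℝ s) z) :=
    hcs0.fderiv
  have hact : DifferentiableAt ℝ (fun y ↦ actL (s y)) z :=
    (((actL (W := W) (k := k)).restrictScalars ℝ).hasFDerivAt.comp z hds.hasFDerivAt).differentiableAt
  have b1 := cplx_bilin (ContinuousLinearMap.compL ℂ W (Coord n × Coord n) (W [⋀^Fin k]→L[ℂ] ℂ)) hcs hR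
  have b2 := cplx_bilin (ContinuousLinearMap.compL ℂ W (W →L[ℂ] W) (W [⋀^Fin k]→L[ℂ] ℂ)) hact hc
  have b3 := cplx_sub_smul b1.1 b2.1 (1 / 2 : ℂ)
  refine ⟨b3.1, fun u b ↦ ?_⟩
  have b4 := congrArg (fun L ↦ L u b) b3.2
  refine b4.trans ?_
  rw [sub_apply, smul_apply, b1.2, b2.2, hcs', cplx_linear actL hds]
  rfl

theorem cplx_anti {c : Coord n → W →L[ℂ] W →L[ℂ] W} {z : Coord n}
    (hc : DifferentiableAt ℝ c z) (hanti : ∀ y a b, c y a b = - c y b a) (u) (a b) :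
    cplx (fderiv ℝ c z) u a b = - cplx (fderiv ℝ c z) u b a := by
  have h1 : cplx (fderiv ℝ (fun y ↦ (c y).flip) z) = _ := cplx_linear
    (ContinuousLinearMap.flipₗᵢ ℂ W W W).toLinearIsometry.toContinuousLinearMap hc
  have h2 : (fun y ↦ (c y).flip) = -c := by
    funext y
    refine ContinuousLinearMap.ext fun a ↦ ContinuousLinearMap.ext fun b ↦ ?_
    exact hanti y b a
  rw [h2, fderiv_neg] at h1
  have h3 : cplx (-fderiv ℝ c z) = - cplx (fderiv ℝ c z) := map_neg cplxL (fderiv ℝ c z)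
  rw [h3] at h1
  have := congrArg (fun L ↦ L u b a) h1
  have h4 : - (cplx (fderiv ℝ c z) u b a) = cplx (fderiv ℝ c z) u a b := this
  rw [h4]

/-- torsion-free curvature -/
def curvS (R : W →L[ℂ] Coord n × Coord n) (c : W →L[ℂ] W →L[ℂ] W)
    (c' : Coord n × Coord n →L[ℂ] W →L[ℂ] W →L[ℂ] W) : W →L[ℂ] W →L[ℂ] W →L[ℂ] W :=
  -(1 / 2 : ℂ) • c'.comp R +
    (1 / 4 : ℂ) • ((ContinuousLinearMap.compL ℂ W W W).comp c).flip.comp c +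
    (1 / 4 : ℂ) • (ContinuousLinearMap.compL ℂ W W (W →L[ℂ] W) c).comp c

theorem curvS_apply (R : W →L[ℂ] Coord n × Coord n) (c : W →L[ℂ] W →L[ℂ] W)
    (c' : Coord n × Coord n →L[ℂ] W →L[ℂ] W →L[ℂ] W) (a b) : curvS R c c' a b =
    -(1 / 2 : ℂ) • c' (R a) b + (1 / 4 : ℂ) • (c b).comp (c a) + (1 / 4 : ℂ) • c (c a b) := rfl

open ContinuousAlternatingMap in
theorem alt_curvS (σ : W [⋀^Fin k]→L[ℂ] ℂ) (S : W →L[ℂ] W →L[ℂ] W →L[ℂ] W)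
    (hS : ∀ a b d, S a b d + S b d a + S d a b = S b a d + S a d b + S d b a) :
    alternatizeUncurryFin ((alternatizeUncurryFinCLM ℂ W ℂ).comp
      ((ContinuousLinearMap.compL ℂ W _ _ (actL σ)).comp S)) = 0 := by
  cases k with
  | zero =>
    have : actL σ = 0 := by
      refine ContinuousLinearMap.ext fun M ↦ ?_
      ext v
      simp [actL_apply]
    rw [this]
    simp only [_root_.map_zero, ContinuousLinearMap.zero_comp, ContinuousLinearMap.comp_zero]
    exact map_zero (alternatizeUncurryFinCLM ℂ W ℂ)
  | succ m =>
    let f : W →L[ℂ] W →L[ℂ] W →L[ℂ] W [⋀^Fin m]→L[ℂ] ℂ :=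
      (ContinuousLinearMap.postcomp W (ContinuousLinearMap.postcomp W σ.curryLeft)).comp S
    have hf (a b d) : f a b d = σ.curryLeft (S a b d) := rfl
    rw [← alt_three f]
    · congr 2
      refine ContinuousLinearMap.ext fun a ↦ ContinuousLinearMap.ext fun b ↦ ?_
      have := fderivCompContinuousLinearMap_eq_alternatizeUncurryFin σ (.id ℂ W)
      change σ.fderivCompContinuousLinearMap (.id ℂ W) (S a b) = alternatizeUncurryFinCLM ℂ W ℂ (f a b)
      rw [this]
      change alternatizeUncurryFinCLM ℂ W ℂ _ = _
      congr 1
    · intro a b d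
      simp only [hf, ← map_add]
      rw [hS]

theorem curvS_bianchi {R : W →L[ℂ] Coord n × Coord n} {c : W →L[ℂ] W →L[ℂ] W}
    {c' : Coord n × Coord n →L[ℂ] W →L[ℂ] W →L[ℂ] W}
    (hc : ∀ a b, c a b = - c b a) (hc' : ∀ u a b, c' u a b = - c' u b a)
    (hjac : ∀ a b d, c (c a b) d + c (c b d) a + c (c d a) b =
      c' (R d) a b + c' (R a) b d + c' (R b) d a) (a b d : W) :
    curvS R c c' a b d + curvS R c c' b d a + curvS R c c' d a b =
      curvS R c c' b a d + curvS R c c' a d b + curvS R c c' d b a := by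
  have j := hjac a b d
  have hS (a b d) : curvS R c c' a b d = -(1 / 2 : ℂ) • c' (R a) b d +
    (1 / 4 : ℂ) • c b (c a d) + (1 / 4 : ℂ) • c (c a b) d := rfl
  simp only [hS]
  rw [hc b (c a d), hc a (c d b), hc d (c b a), hc d (c a b),
    hc b (c d a), hc a (c b d), hc b a, hc a d, hc d b, hc' _ a d, hc' _ b a, hc' _ d b]
  simp only [map_neg, _root_.neg_apply] at j ⊢
  rw [← sub_eq_zero] at j ⊢
  rw [← j]
  module

open ContinuousAlternatingMap in
theorem connD_connD {R : Coord n → W →L[ℂ] Coord n × Coord n} {c : Coord n → W →L[ℂ] W →L[ℂ] W}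
    {s : Coord n → W [⋀^Fin k]→L[ℂ] ℂ} {z : Coord n} (hs : ContDiffAt ℝ ∞ s z)
    (hR : DifferentiableAt ℝ R z) (hc : DifferentiableAt ℝ c z)
    (hanti : ∀ y a b, c y a b = - c y b a)
    (hanch : ∀ a b, cplx (fderiv ℝ R z) (R z a) b - cplx (fderiv ℝ R z) (R z b) a =
      R z (c z a b))
    (hjac : ∀ a b d, c z (c z a b) d + c z (c z b d) a + c z (c z d a) b =
      cplx (fderiv ℝ c z) (R z d) a b + cplx (fderiv ℝ c z) (R z a) b d +
        cplx (fderiv ℝ c z) (R z b) d a) :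
    connD (R z) (c z) (fun y ↦ connD (R y) (c y) s y) z = 0 := by
  obtain ⟨hΦd, hΦcplx⟩ := cplx_nabla hs hR hc
  have hsymm := cplx_cplx_symm (F := W [⋀^Fin k]→L[ℂ] ℂ) (L := fderiv ℝ (fderiv ℝ s) z)
    (fun x y ↦ (hs.isSymmSndFDerivAt (by
      rw [minSmoothness_of_isRCLikeNormedField]; exact WithTop.coe_le_coe.2 le_top)) x y)
  set Φ : Coord n → W →L[ℂ] W [⋀^Fin k]→L[ℂ] ℂ := fun y ↦ nabla (R y) (c y) s y with hΦ
  -- the iterated operator is a double alternation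
  let H : W →L[ℂ] W →L[ℂ] W [⋀^Fin k]→L[ℂ] ℂ := (cplx (fderiv ℝ Φ z)).comp (R z) -
    (1 / 2 : ℂ) • (((ContinuousLinearMap.compL ℂ W _ _).flip (Φ z)).comp
      ((actL (W := W) (k := k)).flip.comp (c z)) + (ContinuousLinearMap.compL ℂ W _ _ (Φ z)).comp (c z))
  have hH (a b) : H a b = cplx (fderiv ℝ Φ z) (R z a) b - (1 / 2 : ℂ) •
    (actL (Φ z b) (c z a) + Φ z (c z a b)) := rfl
  have step1 : connD (R z) (c z) (fun y ↦ connD (R y) (c y) s y) z =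
      alternatizeUncurryFin ((alternatizeUncurryFinCLM ℂ W ℂ).comp H) := by
    have e0 : (fun y ↦ connD (R y) (c y) s y) = fun y ↦ alternatizeUncurryFinCLM ℂ W ℂ (Φ y) := rfl
    rw [e0, connD_eq, cplx_linear _ hΦd]
    congr 1
    refine ContinuousLinearMap.ext fun a ↦ ?_
    have := actL_alt (Φ z) (c z a)
    change alternatizeUncurryFinCLM ℂ W ℂ (cplx (fderiv ℝ Φ z) (R z a)) -
      (1 / 2 : ℂ) • actL (alternatizeUncurryFin (Φ z)) (c z a) = alternatizeUncurryFinCLM ℂ W ℂ (H a)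
    rw [this, ← alternatizeUncurryFinCLM_apply, ← map_smul, ← map_sub]
    rfl
  have hΦz (b) : Φ z b = cplx (fderiv ℝ s z) (R z b) - (1 / 2 : ℂ) • actL (s z) (c z b) := rfl
  rw [step1, ← alt_curvS (s z) _ (curvS_bianchi (R := R z) (c' := cplx (fderiv ℝ c z)) (hanti z)
    (cplx_anti hc hanti) hjac)]
  refine alt_alt_congr fun a b ↦ ?_
  have q1 := hsymm (R z a) (R z b)
  have q2 := congrArg (cplx (fderiv ℝ s z)) (hanch a b)
  have q3 := actL_comm (s z) (c z a) (c z b)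
  change H a b - H b a = actL (s z) (curvS _ _ _ a b) - actL (s z) (curvS _ _ _ b a)
  rw [hH, hH, curvS_apply, curvS_apply, hΦcplx, hΦcplx, hΦz, hΦz, hΦz, hΦz, hanti z b a]
  simp only [map_add, map_sub, map_smul, map_neg, _root_.add_apply, _root_.sub_apply,
    _root_.smul_apply, _root_.neg_apply] at q2 q3 ⊢
  rw [q1]
  rw [sub_eq_iff_eq_add] at q2 q3
  rw [q2, q3]
  module

/-! explicit operators are of the form `connD` -/

theorem cplx_fderiv_apply (s : Coord n → F) (z : Coord n) (u : Coord n × Coord n) :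
    cplx (fderiv ℝ s z) u = ∑ j, u.1 j • wirt j s z + ∑ j, u.2 j • wirtBar j s z := by
  simp only [cplx, _root_.add_apply, _root_.sum_apply, ContinuousLinearMap.smulRight_apply]
  rfl

theorem wedgeOne_eq (α : W →L[ℂ] ℂ) (ψ : W [⋀^Fin k]→L[ℂ] ℂ) : wedgeOne α ψ =
  ContinuousAlternatingMap.alternatizeUncurryFinCLM ℂ W ℂ (α.smulRight ψ) := rfl

theorem delLocal_eq (s : Coord n → (Coord n × Coord n) [⋀^Fin k]→L[ℂ] ℂ) (z : Coord n) :
    delLocal s z = connD ((ContinuousLinearMap.inl ℂ _ _).comp (ContinuousLinearMap.fst ℂ _ _)) 0 s z := by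
  simp only [delLocal, wedgeOne_eq, ← map_sum, connD_eq]
  rw [← ContinuousAlternatingMap.alternatizeUncurryFinCLM_apply]
  congr 1
  refine ContinuousLinearMap.ext fun a ↦ ?_
  simp [cplx_fderiv_apply, dz]

theorem dbarLocal_eq (s : Coord n → (P × Coord n) [⋀^Fin k]→L[ℂ] ℂ) (z : Coord n) :
    dbarLocal s z = connD ((ContinuousLinearMap.inr ℂ _ _).comp (ContinuousLinearMap.snd ℂ _ _)) 0 s z := by
  simp only [dbarLocal, wedgeOne_eq, ← map_sum, connD_eq]
  rw [← ContinuousAlternatingMap.alternatizeUncurryFinCLM_apply]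
  congr 1
  refine ContinuousLinearMap.ext fun a ↦ ?_
  simp [cplx_fderiv_apply, dzBar]

theorem ddz_apply (j : Fin n) (a : Lbar n) : ddz j a = a.1 (Pi.single j 1) := rfl

def sharp (Λ : Coord n → Lbar n [⋀^Fin 2]→L[ℂ] ℂ) (z : Coord n) : Lbar n →L[ℂ] Coord n :=
  -∑ i, ∑ j, coeff Λ i j z • (ddz j).smulRight (Pi.single i 1)

def brack (Λ : Coord n → Lbar n [⋀^Fin 2]→L[ℂ] ℂ) (z : Coord n) : Lbar n →L[ℂ] Lbar n →L[ℂ] Lbar n :=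
  ∑ l, ∑ i, ∑ j, wirt l (coeff Λ i j) z • (ddz i).smulRight ((ddz j).smulRight (dzLbar l))

theorem schoutenLocal_eq (Λ : Coord n → Lbar n [⋀^Fin 2]→L[ℂ] ℂ)
    (s : Coord n → Lbar n [⋀^Fin k]→L[ℂ] ℂ) (z : Coord n) : schoutenLocal Λ s z =
    connD ((ContinuousLinearMap.inl ℂ _ _).comp (sharp Λ z)) (brack Λ z) s z := by
  have h1 : -∑ i, ∑ j, coeff Λ i j z • wedgeOne (ddz j) (wirt i s z) =
      ContinuousAlternatingMap.alternatizeUncurryFinCLM ℂ (Lbar n) ℂ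
        ((cplx (fderiv ℝ s z)).comp ((ContinuousLinearMap.inl ℂ _ _).comp (sharp Λ z))) := by
    simp only [wedgeOne_eq, ← map_sum, ← map_smul, ← map_neg]
    congr 1
    refine ContinuousLinearMap.ext fun a ↦ ?_
    simp [cplx_fderiv_apply, sharp, Pi.single_apply, mul_smul]
  rw [connD_eq, ← ContinuousAlternatingMap.alternatizeUncurryFinCLM_apply, map_sub, ← h1]
  cases k with
  | zero =>
    have : actL (s z) = 0 := by
      refine ContinuousLinearMap.ext fun M ↦ ?_
      ext v
      simp [actL_apply]
    rw [this]
    rw [ContinuousLinearMap.zero_comp, smul_zero, _root_.map_zero, sub_zero]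
    rfl
  | succ k =>
    simp only [schoutenLocal]
    congr 1
    rw [map_smul]
    congr 1
    simp only [wedgeOne_eq, ← map_sum, ← map_smul]
    congr 1
    refine ContinuousLinearMap.ext fun a ↦ ?_
    have := ContinuousAlternatingMap.fderivCompContinuousLinearMap_eq_alternatizeUncurryFin
      (s z) (.id ℂ (Lbar n))
    change _ = (s z).fderivCompContinuousLinearMap (.id ℂ (Lbar n)) (brack Λ z a)
    rw [this]
    simp only [brack, _root_.sum_apply, _root_.smul_apply, ContinuousLinearMap.smulRight_apply,
      ContinuousLinearMap.comp_apply, ← map_smul, ← map_sum]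
    congr 1
    refine ContinuousLinearMap.ext fun b ↦ ?_
    simp only [_root_.sum_apply, _root_.smul_apply, ContinuousLinearMap.smulRight_apply,
      ContinuousLinearMap.comp_apply, map_smul, map_sum, ContinuousLinearMap.postcomp_apply]
    rfl

end Cplx

section Poisson
variable {n k : ℕ}

abbrev Biv (n : ℕ) : Type := Lbar n [⋀^Fin 2]→L[ℂ] ℂ

def lamL (n : ℕ) : Biv n →L[ℂ] Lbar n →L[ℂ] Lbar n →L[ℂ] ℂ :=
  ∑ i, ∑ j, (ContinuousAlternatingMap.apply ℂ (Lbar n) ℂ ![dzLbar i, dzLbar j]).smulRight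
    ((ddz i).smulRight (ddz j))

def sharpL (n : ℕ) : Biv n →L[ℂ] Lbar n →L[ℂ] Coord n :=
  -∑ i, ∑ j, (ContinuousAlternatingMap.apply ℂ (Lbar n) ℂ ![dzLbar i, dzLbar j]).smulRight
    ((ddz j).smulRight (Pi.single i 1))

def brackL (n : ℕ) : (Coord n × Coord n →L[ℂ] Biv n) →L[ℂ] Lbar n →L[ℂ] Lbar n →L[ℂ] Lbar n :=
  ∑ l, ∑ i, ∑ j, ((ContinuousAlternatingMap.apply ℂ (Lbar n) ℂ ![dzLbar i, dzLbar j]).comp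
    (ContinuousLinearMap.apply ℂ (Biv n) ((Pi.single l 1, 0) : Coord n × Coord n))).smulRight
      ((ddz i).smulRight ((ddz j).smulRight (dzLbar l)))

theorem lamL_apply' (σ : Biv n) (a b : Lbar n) :
    lamL n σ a b = ∑ i, ∑ j, σ ![dzLbar i, dzLbar j] * (ddz i a * ddz j b) := by
  simp [lamL]

theorem ddz_dzLbar (i j : Fin n) : ddz i (dzLbar j : Lbar n) = if i = j then 1 else 0 := by
  simp [ddz_apply, dzLbar, Pi.single_apply, eq_comm]

theorem covector_expand (ξ : Coord n →L[ℂ] ℂ) :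
    ((ξ, 0) : Lbar n) = ∑ i, ξ (Pi.single i 1) • dzLbar i := by
  refine Prod.ext ?_ ?_
  · rw [Prod.fst_sum]
    refine ContinuousLinearMap.ext fun v ↦ ?_
    conv_lhs => rw [← Finset.univ_sum_single v, map_sum]
    simp only [_root_.sum_apply]
    refine Finset.sum_congr rfl fun i _ ↦ ?_
    have : (Pi.single i (v i) : Coord n) = v i • Pi.single i 1 := by
      rw [← Pi.single_smul]; simp
    rw [this, map_smul]
    simp [dzLbar, mul_comm]
  · rw [Prod.snd_sum]
    simp [dzLbar]

theorem biv_anti (σ : Biv n) (a b : Lbar n) : σ ![a, b] = - σ ![b, a] := by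
  have := σ.map_swap ![b, a] (i := 0) (j := 1) (by simp)
  refine Eq.trans ?_ this
  refine congrArg σ ?_
  funext i
  fin_cases i <;> simp

theorem biv_sum (σ : Biv n) (c : Fin n → ℂ) (x : Fin n → Lbar n) (y : Lbar n) :
    σ ![∑ i, c i • x i, y] = ∑ i, c i * σ ![x i, y] := by
  change (σ.curryLeft (∑ i, c i • x i)) ![y] = _
  rw [map_sum, ContinuousAlternatingMap.sum_apply]
  refine Finset.sum_congr rfl fun i _ ↦ ?_
  rw [map_smul]
  rfl

theorem lamL_apply (σ : Biv n) (a b : Lbar n) :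
    lamL n σ a b = σ ![(a.1, 0), (b.1, 0)] := by
  rw [lamL_apply', covector_expand a.1, covector_expand b.1, biv_sum]
  refine Finset.sum_congr rfl fun i _ ↦ ?_
  rw [biv_anti, biv_sum, mul_neg, Finset.mul_sum, ← Finset.sum_neg_distrib]
  refine Finset.sum_congr rfl fun j _ ↦ ?_
  rw [biv_anti σ (dzLbar i), ddz_apply, ddz_apply]
  ring

theorem lamL_anti (σ : Biv n) (a b : Lbar n) : lamL n σ a b = - lamL n σ b a := by
  rw [lamL_apply, lamL_apply, biv_anti]

theorem lamL_congr (σ : Biv n) {a a' b b' : Lbar n} (ha : a.1 = a'.1) (hb : b.1 = b'.1) :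
    lamL n σ a b = lamL n σ a' b' := by
  rw [lamL_apply, lamL_apply, ha, hb]

theorem sharpL_apply (σ : Biv n) (a η : Lbar n) : η.1 (sharpL n σ a) = lamL n σ a η := by
  rw [lamL_anti, lamL_apply']
  simp [sharpL, ddz_apply, mul_comm]

theorem sharp_eq (Λ : Coord n → Biv n) (z : Coord n) : sharp Λ z = sharpL n (Λ z) := by
  simp only [sharp, sharpL, _root_.neg_apply, _root_.sum_apply, ContinuousLinearMap.smulRight_apply]
  rfl

theorem wirt_coeff {Λ : Coord n → Biv n} {z : Coord n} (h : DifferentiableAt ℝ Λ z) (l i j : Fin n) :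
    wirt l (coeff Λ i j) z = cplx (fderiv ℝ Λ z) (Pi.single l 1, 0) ![dzLbar i, dzLbar j] := by
  have h1 := cplx_linear (ContinuousAlternatingMap.apply ℂ (Lbar n) ℂ ![dzLbar i, dzLbar j]) h
  have h2 := congrArg (fun L ↦ L (Pi.single l 1, 0)) h1
  refine Eq.trans ?_ h2
  simp only [cplx_fderiv_apply, Pi.single_apply]
  simp
  rfl

theorem brack_eq {Λ : Coord n → Biv n} {z : Coord n} (h : DifferentiableAt ℝ Λ z) :
    brack Λ z = brackL n (cplx (fderiv ℝ Λ z)) := by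
  simp only [brack, brackL, _root_.sum_apply, ContinuousLinearMap.smulRight_apply, wirt_coeff h]
  rfl

theorem brackL_snd (M : Coord n × Coord n →L[ℂ] Biv n) (a b : Lbar n) : (brackL n M a b).2 = 0 := by
  simp [brackL, Prod.snd_sum, dzLbar]

theorem brackL_fst (M : Coord n × Coord n →L[ℂ] Biv n) (a b : Lbar n) (v : Coord n) :
    (brackL n M a b).1 v = lamL n (M (v, 0)) a b := by
  have hv : ((v, 0) : Coord n × Coord n) = ∑ l, v l • (Pi.single l 1, 0) := by
    refine Prod.ext ?_ ?_
    · rw [Prod.fst_sum]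
      ext i
      simp [Finset.sum_apply, Pi.single_apply]
    · rw [Prod.snd_sum]; simp
  rw [hv, map_sum, map_sum]
  simp only [map_smul, _root_.sum_apply, _root_.smul_apply, lamL_apply']
  simp [brackL, Prod.fst_sum, dzLbar, Finset.mul_sum, mul_comm, mul_left_comm, mul_assoc]

theorem brackL_anti (M : Coord n × Coord n →L[ℂ] Biv n) (a b : Lbar n) :
    brackL n M a b = - brackL n M b a := by
  refine Prod.ext (ContinuousLinearMap.ext fun v ↦ ?_) ?_
  · rw [brackL_fst, lamL_anti, ← brackL_fst]; rfl
  · simp [brackL_snd]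

theorem coeff_anti (Λ : Coord n → Biv n) (i j : Fin n) : coeff Λ i j = - coeff Λ j i := by
  funext z
  exact biv_anti _ _ _

theorem brack_anti (Λ : Coord n → Biv n) (z : Coord n) (a b : Lbar n) :
    brack Λ z a b = - brack Λ z b a := by
  have hw (l i j : Fin n) : wirt l (coeff Λ i j) z = - wirt l (coeff Λ j i) z := by
    rw [coeff_anti]
    simp only [wirt, fderiv_neg, _root_.neg_apply]
    module
  simp only [brack, _root_.sum_apply, _root_.smul_apply, ContinuousLinearMap.smulRight_apply,
    ← Finset.sum_neg_distrib]
  refine Finset.sum_congr rfl fun l _ ↦ ?_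
  rw [Finset.sum_comm]
  refine Finset.sum_congr rfl fun i _ ↦ Finset.sum_congr rfl fun j _ ↦ ?_
  rw [hw]
  module

/-- anchor of the Poisson algebroid -/
def anchorP (σ : Biv n) : Lbar n →L[ℂ] Coord n × Coord n :=
  (ContinuousLinearMap.inl ℂ _ _).comp (sharpL n σ) +
    (ContinuousLinearMap.inr ℂ _ _).comp (ContinuousLinearMap.snd ℂ _ _)

theorem anchorP_apply (σ : Biv n) (a : Lbar n) : anchorP σ a = (sharpL n σ a, a.2) := by
  simp [anchorP]

theorem dbar_add_schouten {Λ : Coord n → Biv n} {z : Coord n} (h : DifferentiableAt ℝ Λ z)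
    (s : Coord n → Lbar n [⋀^Fin k]→L[ℂ] ℂ) :
    dbarLocal s z + schoutenLocal Λ s z =
      connD (anchorP (Λ z)) (brackL n (cplx (fderiv ℝ Λ z))) s z := by
  rw [dbarLocal_eq, schoutenLocal_eq, connD_nabla, connD_nabla, connD_nabla, ← map_add, sharp_eq,
    brack_eq h]
  congr 1
  refine ContinuousLinearMap.ext fun a ↦ ?_
  rw [_root_.add_apply, nabla_apply, nabla_apply, nabla_apply]
  have : anchorP (Λ z) a = ((ContinuousLinearMap.inr ℂ (Coord n) (Coord n)).comp (ContinuousLinearMap.snd ℂ _ _)) a +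
    ((ContinuousLinearMap.inl ℂ (Coord n) (Coord n)).comp (sharpL n (Λ z))) a := by
    simp [anchorP]
  rw [this, map_add]
  simp only [_root_.zero_apply, map_zero, smul_zero, sub_zero]
  abel

theorem alt_apply_three {W : Type*} [NormedAddCommGroup W] [NormedSpace ℂ W]
    (Φ : W →L[ℂ] W [⋀^Fin 2]→L[ℂ] ℂ) (x y z : W) :
    ContinuousAlternatingMap.alternatizeUncurryFinCLM ℂ W ℂ Φ ![x, y, z] =
      Φ x ![y, z] - Φ y ![x, z] + Φ z ![x, y] := by
  rw [ContinuousAlternatingMap.alternatizeUncurryFinCLM_apply,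
    ContinuousAlternatingMap.alternatizeUncurryFin_apply, Fin.sum_univ_castSucc,
    Fin.sum_univ_castSucc, Fin.sum_univ_castSucc]
  have e0 : (Fin.castSucc (Fin.castSucc (Fin.last 0))).removeNth ![x, y, z] = ![y, z] := by
    funext i; fin_cases i <;> rfl
  have e1 : (Fin.castSucc (Fin.last 1)).removeNth ![x, y, z] = ![x, z] := by
    funext i; fin_cases i <;> rfl
  have e2 : (Fin.last 2).removeNth ![x, y, z] = ![x, y] := by
    funext i; fin_cases i <;> rfl
  rw [e0, e1, e2]
  simp
  rfl

theorem dbar_biv {Λ : Coord n → Biv n} {z : Coord n} (h : dbarLocal Λ z = 0) (w : Coord n) :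
    lamL n (cplx (fderiv ℝ Λ z) (0, w)) = 0 := by
  refine ContinuousLinearMap.ext fun a ↦ ContinuousLinearMap.ext fun b ↦ ?_
  have h1 := congrArg (fun σ ↦ σ ![(0, w), (a.1, 0), (b.1, 0)]) h
  rw [dbarLocal_eq, connD_nabla] at h1
  rw [alt_apply_three, nabla_apply, nabla_apply, nabla_apply] at h1
  rw [lamL_apply]
  have hz : ((0, 0) : Coord n × Coord n) = 0 := rfl
  simpa [hz] using h1

theorem actL_two (σ : Biv n) (M : Lbar n →L[ℂ] Lbar n) (x y : Lbar n) :
    actL σ M ![x, y] = σ ![M x, y] + σ ![x, M y] := by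
  rw [actL_apply, Fin.sum_univ_two]
  congr 1
  · refine congrArg σ (funext fun i ↦ ?_)
    fin_cases i <;> rfl
  · refine congrArg σ (funext fun i ↦ ?_)
    fin_cases i <;> rfl

theorem schouten_biv {Λ : Coord n → Biv n} {z : Coord n} (hd : DifferentiableAt ℝ Λ z)
    (h : schoutenLocal Λ Λ z = 0) (a b d : Lbar n) :
    lamL n (cplx (fderiv ℝ Λ z) (sharpL n (Λ z) d, 0)) a b +
      lamL n (cplx (fderiv ℝ Λ z) (sharpL n (Λ z) a, 0)) b d +
      lamL n (cplx (fderiv ℝ Λ z) (sharpL n (Λ z) b, 0)) d a = 0 := by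
  have hp (x : Lbar n) : sharpL n (Λ z) (x.1, 0) = sharpL n (Λ z) x := by
    simp [sharpL, ddz_apply]
  have hbp (x y : Lbar n) : brackL n (cplx (fderiv ℝ Λ z)) (x.1, 0) (y.1, 0) =
      brackL n (cplx (fderiv ℝ Λ z)) x y := by
    simp [brackL, ddz_apply]
  have h1 := congrArg (fun σ ↦ σ ![(a.1, 0), (b.1, 0), (d.1, 0)]) h
  rw [schoutenLocal_eq, connD_nabla, sharp_eq, brack_eq hd] at h1
  rw [alt_apply_three, nabla_apply, nabla_apply, nabla_apply] at h1
  have key (x y t : Lbar n) : (Λ z) ![brackL n (cplx (fderiv ℝ Λ z)) x y, (t.1, 0)] =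
      - lamL n (cplx (fderiv ℝ Λ z) (sharpL n (Λ z) t, 0)) x y := by
    have : brackL n (cplx (fderiv ℝ Λ z)) x y = ((brackL n (cplx (fderiv ℝ Λ z)) x y).1, 0) :=
      Prod.ext rfl (brackL_snd _ _ _)
    rw [this, ← lamL_apply, lamL_anti, ← sharpL_apply, brackL_fst]
  simp only [ContinuousAlternatingMap.sub_apply, ContinuousAlternatingMap.smul_apply, actL_two,
    ContinuousLinearMap.comp_apply, hp, hbp, biv_anti _ _ (brackL n _ _ _), key, ContinuousLinearMap.inl_apply] at h1
  rw [← lamL_apply, ← lamL_apply, ← lamL_apply] at h1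
  have r1 := lamL_anti (cplx (fderiv ℝ Λ z) (sharpL n (Λ z) d, 0)) a b
  have r2 := lamL_anti (cplx (fderiv ℝ Λ z) (sharpL n (Λ z) a, 0)) b d
  have r3 := lamL_anti (cplx (fderiv ℝ Λ z) (sharpL n (Λ z) b, 0)) d a
  simp only [smul_eq_mul] at h1
  have h2 : (0 : Lbar n [⋀^Fin (2 + 1)]→L[ℂ] ℂ) ![(a.1, 0), (b.1, 0), (d.1, 0)] = 0 := rfl
  rw [h2] at h1
  linear_combination (1 / 2) * h1 + (1 / 4) * r1 + (1/4) * r2 + (3/4) * r3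

section Abstract
open Filter Topology
variable {W B : Type*} [NormedAddCommGroup W] [NormedSpace ℂ W] [NormedAddCommGroup B]
  [NormedSpace ℂ B] [NormedSpace ℝ B] [IsScalarTower ℝ ℂ B]

theorem lam_split {lam : B →L[ℂ] W →L[ℂ] W →L[ℂ] ℂ} {M : Coord n × Coord n →L[ℂ] B}
    {v w : Coord n} (h : lam (M (0, w)) = 0) : lam (M (v, w)) = lam (M (v, 0)) := by
  have : ((v, w) : Coord n × Coord n) = (v, 0) + (0, w) := by simp
  rw [this, map_add, map_add, h, add_zero]

/-- first and second derivatives of a field `Λ` -/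
theorem cplx_second {Λ : Coord n → B} {z : Coord n} (hΛ : ContDiffAt ℝ ∞ Λ z) :
    DifferentiableAt ℝ (fun y ↦ cplx (fderiv ℝ Λ y)) z ∧
    ∀ u v, cplx (fderiv ℝ (fun y ↦ cplx (fderiv ℝ Λ y)) z) u v =
      cplx (fderiv ℝ (fun y ↦ cplx (fderiv ℝ Λ y)) z) v u := by
  have hdd : DifferentiableAt ℝ (fderiv ℝ Λ) z :=
    (hΛ.fderiv_right (m := 1) (by norm_cast)).differentiableAt (by simp)
  have hM0 := ((cplxL (n := n) (F := B)).hasFDerivAt.comp z hdd.hasFDerivAt)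
  have hMd' : fderiv ℝ (fun y ↦ cplx (fderiv ℝ Λ y)) z = cplxL.comp (fderiv ℝ (fderiv ℝ Λ) z) :=
    hM0.fderiv
  refine ⟨hM0.differentiableAt, ?_⟩
  rw [hMd']
  exact cplx_cplx_symm (F := B) (L := fderiv ℝ (fderiv ℝ Λ) z)
    (fun x y ↦ (hΛ.isSymmSndFDerivAt (by
      rw [minSmoothness_of_isRCLikeNormedField]; exact WithTop.coe_le_coe.2 le_top)) x y)

theorem cplx_const_zero {G : Type*} [NormedAddCommGroup G] [NormedSpace ℂ G] [NormedSpace ℝ G]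
    [IsScalarTower ℝ ℂ G] {g : Coord n → G} {z : Coord n} (h : ∀ᶠ y in 𝓝 z, g y = 0) :
    cplx (fderiv ℝ g z) = 0 := by
  have e : g =ᶠ[𝓝 z] fun _ ↦ 0 := h
  refine ContinuousLinearMap.ext fun u ↦ ?_
  rw [e.fderiv_eq]
  simp [cplx_apply]

theorem lam_hol' {lam : B →L[ℂ] W →L[ℂ] W →L[ℂ] ℂ} {Λ : Coord n → B} {z : Coord n}
    (hΛ : ContDiffAt ℝ ∞ Λ z) {w : Coord n} (a b : W)
    (hhol : ∀ᶠ y in 𝓝 z, lam (cplx (fderiv ℝ Λ y) (0, w)) a b = 0) (u : Coord n × Coord n) :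
    lam (cplx (fderiv ℝ (fun y ↦ cplx (fderiv ℝ Λ y)) z) u (0, w)) a b = 0 := by
  have e2 := cplx_linear (((lam.flip a).flip b).comp (ContinuousLinearMap.apply ℂ B
        ((0, w) : Coord n × Coord n))) (cplx_second hΛ).1
  have e3 := (congrArg (fun L ↦ L u) e2).symm
  refine e3.trans (congrArg (fun L ↦ L u) (cplx_const_zero hhol))

theorem lam_pois' {lam : B →L[ℂ] W →L[ℂ] W →L[ℂ] ℂ} {sh : B →L[ℂ] W →L[ℂ] Coord n}
    {Λ : Coord n → B} {z : Coord n} (hΛ : ContDiffAt ℝ ∞ Λ z) (a b d : W) :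
    DifferentiableAt ℝ (fun y ↦ lam (cplx (fderiv ℝ Λ y) (sh (Λ y) d, 0)) a b) z ∧
    ∀ u, cplx (fderiv ℝ (fun y ↦ lam (cplx (fderiv ℝ Λ y) (sh (Λ y) d, 0)) a b) z) u =
      lam (cplx (fderiv ℝ (fun y ↦ cplx (fderiv ℝ Λ y)) z) u (sh (Λ z) d, 0)) a b +
      lam (cplx (fderiv ℝ Λ z) (sh (cplx (fderiv ℝ Λ z) u) d, 0)) a b := by
  let C : (Coord n × Coord n →L[ℂ] B) →L[ℂ] B →L[ℂ] ℂ :=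
    ((ContinuousLinearMap.compL ℂ B (Coord n × Coord n) ℂ).flip
      ((ContinuousLinearMap.inl ℂ (Coord n) (Coord n)).comp (sh.flip d))).comp
      (ContinuousLinearMap.compL ℂ (Coord n × Coord n) B ℂ ((lam.flip a).flip b))
  exact cplx_bilin C (cplx_second hΛ).1 (hΛ.differentiableAt (by simp))

variable {lam : B →L[ℂ] W →L[ℂ] W →L[ℂ] ℂ} {sh : B →L[ℂ] W →L[ℂ] Coord n}
  {br : (Coord n × Coord n →L[ℂ] B) →L[ℂ] W →L[ℂ] W →L[ℂ] W} {e : Fin n → W}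
  {fs : W →L[ℂ] Coord n →L[ℂ] ℂ} {sn : W →L[ℂ] Coord n}
  {Λ : Coord n → B} {z : Coord n}

theorem abstract_jacobi (hext : ∀ a b : W, (∀ v, fs a v = fs b v) → sn a = sn b → a = b)
    (hbr : ∀ M a b v, fs (br M a b) v = lam (M (v, 0)) a b) (hbr2 : ∀ M a b, sn (br M a b) = 0)
    (hlam : ∀ σ a b, lam σ a b = - fs a (sh σ b))
    (hΛ : ContDiffAt ℝ ∞ Λ z)
    (hhol : ∀ w a b, ∀ᶠ y in 𝓝 z, lam (cplx (fderiv ℝ Λ y) (0, w)) a b = 0)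
    (hpois : ∀ a b d, ∀ᶠ y in 𝓝 z, lam (cplx (fderiv ℝ Λ y) (sh (Λ y) d, 0)) a b +
      lam (cplx (fderiv ℝ Λ y) (sh (Λ y) a, 0)) b d +
      lam (cplx (fderiv ℝ Λ y) (sh (Λ y) b, 0)) d a = 0) (a b d : W) :
    br (cplx (fderiv ℝ Λ z)) (br (cplx (fderiv ℝ Λ z)) a b) d +
      br (cplx (fderiv ℝ Λ z)) (br (cplx (fderiv ℝ Λ z)) b d) a +
      br (cplx (fderiv ℝ Λ z)) (br (cplx (fderiv ℝ Λ z)) d a) b =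
    cplx (fderiv ℝ (fun y ↦ br (cplx (fderiv ℝ Λ y))) z) (sh (Λ z) d, sn d) a b +
      cplx (fderiv ℝ (fun y ↦ br (cplx (fderiv ℝ Λ y))) z) (sh (Λ z) a, sn a) b d +
      cplx (fderiv ℝ (fun y ↦ br (cplx (fderiv ℝ Λ y))) z) (sh (Λ z) b, sn b) d a := by
  obtain ⟨hMd, hsymm⟩ := cplx_second hΛ
  have hQ' := fun u w a b ↦ lam_hol' hΛ a b (hhol w a b) u
  have hc (u) := congrArg (fun L ↦ L u) (cplx_linear br hMd)
  have hL := fun a b d ↦ lam_pois' (lam := lam) (sh := sh) hΛ a b d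
  have hP := fun a b d ↦ cplx_const_zero (hpois a b d)
  have k1 (a b d : W) (v) : fs (br (cplx (fderiv ℝ Λ z)) (br (cplx (fderiv ℝ Λ z)) a b) d) v =
      - lam (cplx (fderiv ℝ Λ z) (sh (cplx (fderiv ℝ Λ z) (v, 0)) d, 0)) a b := by
    rw [hbr, hlam, hbr]
  have k2 (a b d : W) (v) :
      fs (cplx (fderiv ℝ (fun y ↦ br (cplx (fderiv ℝ Λ y))) z) (sh (Λ z) d, sn d) a b) v =
        lam (cplx (fderiv ℝ (fun y ↦ cplx (fderiv ℝ Λ y)) z) (v, 0) (sh (Λ z) d, 0)) a b := by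
    have h0 : lam (cplx (fderiv ℝ (fun y ↦ cplx (fderiv ℝ Λ y)) z) (sh (Λ z) d, sn d) (v, 0)) a b =
        lam (cplx (fderiv ℝ (fun y ↦ cplx (fderiv ℝ Λ y)) z) (v, 0) (sh (Λ z) d, 0)) a b := by
      rw [hsymm (sh (Λ z) d, sn d)]
      have : ((sh (Λ z) d, sn d) : Coord n × Coord n) = (sh (Λ z) d, 0) + (0, sn d) := by simp
      rw [this, map_add, map_add, add_apply, add_apply, hQ', add_zero]
    exact (congrArg (fun L ↦ fs (L a b) v) (hc (sh (Λ z) d, sn d))).trans ((hbr _ a b v).trans h0)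
  have k3 (u) (a b : W) :
      sn (cplx (fderiv ℝ (fun y ↦ br (cplx (fderiv ℝ Λ y))) z) u a b) = 0 :=
    (congrArg (fun L ↦ sn (L a b)) (hc u)).trans (hbr2 _ _ _)
  refine hext _ _ (fun v ↦ ?_) (by simp only [map_add, hbr2, k3])
  have e1 := (((hL a b d).1.hasFDerivAt.add (hL b d a).1.hasFDerivAt).add
      (hL d a b).1.hasFDerivAt).fderiv
  have e2 := congrArg (fun L ↦ cplx L (v, 0)) e1
  have e3 := (e2.symm.trans (congrArg (fun L ↦ L (v, 0)) (hP a b d)))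
  simp only [cplx_add, add_apply, (hL _ _ _).2] at e3
  simp only [map_add, add_apply, k1, k2]
  refine Eq.trans ?_ (zero_add _)
  rw [← sub_eq_iff_eq_add, ← neg_eq_zero]
  refine Eq.trans ?_ e3
  ring

theorem abstract_anchor (he : ∀ σ a j, sh σ a j = lam σ a (e j))
    (hbr : ∀ M a b v, fs (br M a b) v = lam (M (v, 0)) a b) (hbr2 : ∀ M a b, sn (br M a b) = 0)
    (hlam : ∀ σ a b, lam σ a b = - fs a (sh σ b)) (hlam' : ∀ σ a b, lam σ a b = - lam σ b a)
    {R : Coord n → W →L[ℂ] Coord n × Coord n}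
    (hR : ∀ y, R y = (ContinuousLinearMap.inl ℂ _ _).comp (sh (Λ y)) +
      (ContinuousLinearMap.inr ℂ _ _).comp sn)
    (hd : DifferentiableAt ℝ Λ z)
    (hhol : ∀ w a b, lam (cplx (fderiv ℝ Λ z) (0, w)) a b = 0)
    (hpois : ∀ a b d, lam (cplx (fderiv ℝ Λ z) (sh (Λ z) d, 0)) a b +
      lam (cplx (fderiv ℝ Λ z) (sh (Λ z) a, 0)) b d +
      lam (cplx (fderiv ℝ Λ z) (sh (Λ z) b, 0)) d a = 0) :
    DifferentiableAt ℝ R z ∧ ∀ a b, cplx (fderiv ℝ R z) (R z a) b -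
      cplx (fderiv ℝ R z) (R z b) a = R z (br (cplx (fderiv ℝ Λ z)) a b) := by
  let A : B →L[ℂ] W →L[ℂ] Coord n × Coord n :=
    (ContinuousLinearMap.compL ℂ W (Coord n) (Coord n × Coord n)
      (ContinuousLinearMap.inl ℂ _ _)).comp sh
  have hR0 : R = fun y ↦ A (Λ y) + (ContinuousLinearMap.inr ℂ _ _).comp sn := funext hR
  have hAd : DifferentiableAt ℝ (fun y ↦ A (Λ y)) z :=
    ((A.restrictScalars ℝ).hasFDerivAt.comp z hd.hasFDerivAt).differentiableAt
  have hRz (a) : R z a = (sh (Λ z) a, sn a) := by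
    rw [hR]; simp
  have hc (u b) : cplx (fderiv ℝ R z) u b = (sh (cplx (fderiv ℝ Λ z) u) b, 0) := by
    rw [hR0, fderiv_add_const, cplx_linear A hd]
    rfl
  refine ⟨hR0 ▸ hAd.add_const _, fun a b ↦ ?_⟩
  rw [hc, hc, hRz, hRz, hRz, hbr2]
  refine Prod.ext (funext fun j ↦ ?_) (by simp)
  have s1 (a b : W) : lam (cplx (fderiv ℝ Λ z) (sh (Λ z) a, sn a)) b (e j) =
      lam (cplx (fderiv ℝ Λ z) (sh (Λ z) a, 0)) b (e j) := by
    have : ((sh (Λ z) a, sn a) : Coord n × Coord n) = (sh (Λ z) a, 0) + (0, sn a) := by simp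
    rw [this, map_add, map_add, add_apply, add_apply, hhol, add_zero]
  change sh _ b j - sh _ a j = sh _ _ j
  rw [he, he, he, s1, s1, hlam (Λ z), hbr]
  have h1 := hpois a b (e j)
  rw [hlam' _ (e j) a] at h1
  linear_combination h1

end Abstract

theorem sharpL_coord (σ : Biv n) (a : Lbar n) (j : Fin n) :
    sharpL n σ a j = lamL n σ a (dzLbar j) :=
  sharpL_apply σ a (dzLbar j)

theorem lamL_sharp (σ : Biv n) (a b : Lbar n) :
    lamL n σ a b = - ContinuousLinearMap.fst ℂ (Coord n →L[ℂ] ℂ) (Coord n) a (sharpL n σ b) := by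
  rw [lamL_anti, ← sharpL_apply]; rfl

open Filter Topology in
theorem poisson_square {Λ : Coord n → Biv n} {z : Coord n} (hΛ : ContDiffAt ℝ ∞ Λ z)
    (hhol : ∀ᶠ y in 𝓝 z, dbarLocal Λ y = 0) (hpois : ∀ᶠ y in 𝓝 z, schoutenLocal Λ Λ y = 0)
    {s : Coord n → Lbar n [⋀^Fin k]→L[ℂ] ℂ} (hs : ContDiffAt ℝ ∞ s z) :
    connD (anchorP (Λ z)) (brackL n (cplx (fderiv ℝ Λ z)))
      (fun y ↦ connD (anchorP (Λ y)) (brackL n (cplx (fderiv ℝ Λ y))) s y) z = 0 := by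
  have hev : ∀ᶠ y in 𝓝 z, DifferentiableAt ℝ Λ y := by
    filter_upwards [(hΛ.of_le (m := 1) (by norm_cast)).eventually (by simp)] with y hy
    exact hy.differentiableAt (by simp)
  have hol (w : Coord n) (a b : Lbar n) :
      ∀ᶠ y in 𝓝 z, lamL n (cplx (fderiv ℝ Λ y) (0, w)) a b = 0 := by
    filter_upwards [hhol] with y hy
    rw [dbar_biv hy w]
    rfl
  have pois (a b d : Lbar n) :=
    (hpois.and hev).mono fun y hy ↦ schouten_biv hy.2 hy.1 a b d
  have h1 := abstract_anchor (e := dzLbar) (sn := .snd ℂ (Coord n →L[ℂ] ℂ) (Coord n))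
    (R := fun y ↦ anchorP (Λ y)) sharpL_coord brackL_fst brackL_snd lamL_sharp lamL_anti
    (fun _ ↦ rfl) hev.self_of_nhds (fun w a b ↦ (hol w a b).self_of_nhds)
    (fun a b d ↦ (pois a b d).self_of_nhds)
  have h2 := abstract_jacobi (fs := .fst ℂ (Coord n →L[ℂ] ℂ) (Coord n))
    (sn := .snd ℂ (Coord n →L[ℂ] ℂ) (Coord n))
    (fun a b h h' ↦ Prod.ext (ContinuousLinearMap.ext h) h') brackL_fst brackL_snd lamL_sharp
    hΛ hol pois
  refine connD_connD (R := fun y ↦ anchorP (Λ y)) (c := fun y ↦ brackL n (cplx (fderiv ℝ Λ y)))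
    hs h1.1 ?_ (fun y a b ↦ brackL_anti _ a b) h1.2 ?_
  · exact (((brackL n).restrictScalars ℝ).hasFDerivAt.comp z
      (cplx_second hΛ).1.hasFDerivAt).differentiableAt
  · intro a b d
    simp only [anchorP_apply]
    exact h2 a b d

end Poisson

/-! ### Changes of charts -/

section
variable {n k : ℕ}
variable {F : Type*} [NormedAddCommGroup F] [NormedSpace ℂ F] [NormedSpace ℝ F]

section Manifold
open Filter Topology

variable {X : Type*} [TopologicalSpace X]

variable [ChartedSpace (Coord n) X] [IsManifold 𝓘(ℂ, Coord n) ω X]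

theorem overlap_mem {e e' : OpenPartialHomeomorph X (Coord n)} {z : Coord n}
    (hz : z ∈ (e.symm.trans e').source) : z ∈ e.target ∧ e.symm z ∈ e'.source := by
  simpa using hz

theorem overlap_nhds {e e' : OpenPartialHomeomorph X (Coord n)} {z : Coord n}
    (hz : z ∈ (e.symm.trans e').source) : ∀ᶠ y in 𝓝 z, y ∈ (e.symm.trans e').source :=
  (e.symm.trans e').open_source.mem_nhds hz

theorem overlap_symm {e e' : OpenPartialHomeomorph X (Coord n)} {z : Coord n}
    (hz : z ∈ (e.symm.trans e').source) :
    (e' ∘ e.symm) z ∈ (e'.symm.trans e).source ∧ (e ∘ e'.symm) ((e' ∘ e.symm) z) = z := by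
  obtain ⟨h1, h2⟩ := overlap_mem hz
  simp [h1, h2]

theorem transition_contDiffAt {e e' : OpenPartialHomeomorph X (Coord n)}
    (he : e ∈ atlas (Coord n) X) (he' : e' ∈ atlas (Coord n) X) {z : Coord n}
    (hz : z ∈ (e.symm.trans e').source) : ContDiffAt ℂ ω (e' ∘ e.symm) z := by
  have h := (contDiffGroupoid ω 𝓘(ℂ, Coord n)).compatible he he'
  have h2 := (contMDiffOn_of_mem_contDiffGroupoid h).contDiffOn
  exact h2.contDiffAt ((e.symm.trans e').open_source.mem_nhds hz)

theorem jac_contDiffAt {e e' : OpenPartialHomeomorph X (Coord n)}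
    (he : e ∈ atlas (Coord n) X) (he' : e' ∈ atlas (Coord n) X) {z : Coord n}
    (hz : z ∈ (e.symm.trans e').source) : ContDiffAt ℂ ω (jac e e') z :=
  (transition_contDiffAt he he' hz).fderiv_right (m := ω) (by simp)

theorem jac_jac {e e' : OpenPartialHomeomorph X (Coord n)}
    (he : e ∈ atlas (Coord n) X) (he' : e' ∈ atlas (Coord n) X) {z : Coord n}
    (hz : z ∈ (e.symm.trans e').source) (v : Coord n) :
    jac e' e ((e' ∘ e.symm) z) (jac e e' z v) = v := by
  have h1 := ((transition_contDiffAt he he' hz).differentiableAt (by simp)).hasFDerivAt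
  have h2 := ((transition_contDiffAt he' he (overlap_symm hz).1).differentiableAt
    (by simp)).hasFDerivAt
  have h3 := (h2.comp z h1).fderiv
  have h4 : ((e ∘ e'.symm) ∘ (e' ∘ e.symm)) =ᶠ[𝓝 z] id := by
    filter_upwards [overlap_nhds hz] with y hy
    exact (overlap_symm hy).2
  rw [h4.fderiv_eq, fderiv_id] at h3
  exact (congrArg (fun L ↦ L v) h3).symm

theorem jac_jac' {e e' : OpenPartialHomeomorph X (Coord n)}
    (he : e ∈ atlas (Coord n) X) (he' : e' ∈ atlas (Coord n) X) {z : Coord n}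
    (hz : z ∈ (e.symm.trans e').source) (v : Coord n) :
    jac e e' z (jac e' e ((e' ∘ e.symm) z) v) = v := by
  have h := jac_jac he' he (overlap_symm hz).1 v
  rwa [(overlap_symm hz).2] at h

/-- `conjL` as a real linear map -/
def conjLL (n : ℕ) : (Coord n →L[ℂ] Coord n) →L[ℝ] (Coord n →L[ℂ] Coord n) :=
  LinearMap.mkContinuous
    { toFun := conjL
      map_add' := fun A B ↦ by ext; simp
      map_smul' := fun c A ↦ by ext; simp } 1 fun A ↦ by
    rw [one_mul]
    refine ContinuousLinearMap.opNorm_le_bound _ (norm_nonneg _) fun w ↦ ?_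
    change ‖star (A (star w))‖ ≤ _
    rw [norm_star]
    refine (A.le_opNorm _).trans_eq ?_
    rw [norm_star]

theorem conjLL_apply (A : Coord n →L[ℂ] Coord n) : conjLL n A = conjL A := rfl

theorem cplx_holo {g : Coord n → F} [IsScalarTower ℝ ℂ F] {z : Coord n} (hg : DifferentiableAt ℂ g z)
    (u : Coord n × Coord n) : cplx (fderiv ℝ g z) u = fderiv ℂ g z u.1 := by
  rw [hg.fderiv_restrictScalars ℝ, cplx_apply]
  simp only [ContinuousLinearMap.coe_restrictScalars', map_smul]
  simp only [smul_smul, Complex.I_mul_I]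
  module

theorem cplx_antiholo {A : Coord n → Coord n →L[ℂ] Coord n} {z : Coord n}
    (hA : DifferentiableAt ℂ A z) (u : Coord n × Coord n) (b : Coord n) :
    cplx (fderiv ℝ (fun y ↦ conjL (A y)) z) u b = star (fderiv ℂ A z (star u.2) (star b)) := by
  have h := ((conjLL n).hasFDerivAt.comp z (hA.hasFDerivAt.restrictScalars ℝ)).fderiv
  have h' : fderiv ℝ (fun y ↦ conjL (A y)) z = (conjLL n).comp ((fderiv ℂ A z).restrictScalars ℝ) := h
  rw [h', cplx_apply]
  simp only [ContinuousLinearMap.comp_apply, ContinuousLinearMap.coe_restrictScalars', map_smul,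
    conjLL_apply, _root_.add_apply, _root_.sub_apply, _root_.smul_apply, conjL_apply, star_smul, smul_smul]
  simp only [RCLike.star_def, Complex.conj_I, mul_neg, Complex.I_mul_I]
  module

theorem conj_contDiffAt {A : Coord n → Coord n →L[ℂ] Coord n} {z : Coord n}
    (hA : ContDiffAt ℂ ω A z) : ContDiffAt ℝ ∞ (fun y ↦ conjL (A y)) z :=
  (conjLL n).contDiff.contDiffAt.comp z ((hA.restrict_scalars ℝ).of_le le_top)

section Frames
variable {e e' : OpenPartialHomeomorph X (Coord n)} {z : Coord n}

theorem prodMap_diff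
    (he : e ∈ atlas (Coord n) X) (he' : e' ∈ atlas (Coord n) X)
    (hz : z ∈ (e.symm.trans e').source) {P : Type*} [NormedAddCommGroup P] [NormedSpace ℂ P]
    {A : Coord n → P →L[ℂ] P} (hA : DifferentiableAt ℂ A z) :
    DifferentiableAt ℝ (fun y ↦ (A y).prodMap (conjL (jac e e' y))) z ∧
    ∀ u (b : P × Coord n), cplx (fderiv ℝ (fun y ↦ (A y).prodMap (conjL (jac e e' y))) z) u b =
      (fderiv ℂ A z u.1 b.1, star (fderiv ℂ (jac e e') z (star u.2) (star b.2))) := by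
  have hJ := (jac_contDiffAt he he' hz).differentiableAt (by simp)
  have hJc := (conj_contDiffAt (jac_contDiffAt he he' hz)).differentiableAt (by simp)
  have hA' : DifferentiableAt ℝ A z := hA.restrictScalars ℝ
  let B := ContinuousLinearMap.prodMapL ℂ P P (Coord n) (Coord n)
  let B₁ := B.comp (ContinuousLinearMap.inl ℂ _ _)
  let B₂ := B.comp (ContinuousLinearMap.inr ℂ _ _)
  have hB : (fun y ↦ (A y).prodMap (conjL (jac e e' y))) =
      fun y ↦ B₁ (A y) + B₂ (conjL (jac e e' y)) := by
    funext y
    refine ContinuousLinearMap.ext fun b ↦ ?_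
    change _ = ((A y) b.1, (0 : Coord n →L[ℂ] Coord n) b.2) +
      ((0 : P →L[ℂ] P) b.1, conjL (jac e e' y) b.2)
    simp [Prod.map]
  have h1 := ((B₁.restrictScalars ℝ).hasFDerivAt.comp z hA'.hasFDerivAt)
  have h2 := ((B₂.restrictScalars ℝ).hasFDerivAt.comp z hJc.hasFDerivAt)
  have h3 := h1.add h2
  rw [hB]
  refine ⟨h3.differentiableAt, fun u b ↦ ?_⟩
  have h4 : fderiv ℝ (fun y ↦ B₁ (A y) + B₂ (conjL (jac e e' y))) z = _ := h3.fderiv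
  rw [h4, cplx_add, cplx_comp, cplx_comp]
  change (cplx (fderiv ℝ A z) u b.1, (0 : Coord n →L[ℂ] Coord n) b.2) +
    ((0 : P →L[ℂ] P) b.1, cplx (fderiv ℝ (fun y ↦ conjL (jac e e' y)) z) u b.2) = _
  rw [cplx_holo hA, cplx_antiholo hJ]
  simp

theorem jac_symm
    (he : e ∈ atlas (Coord n) X) (he' : e' ∈ atlas (Coord n) X)
    (hz : z ∈ (e.symm.trans e').source) (u v : Coord n) :
    fderiv ℂ (jac e e') z u v = fderiv ℂ (jac e e') z v u :=
  (transition_contDiffAt he he' hz).isSymmSndFDerivAt (by simp) u v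

end Frames

variable {W : Type*} [NormedAddCommGroup W] [NormedSpace ℂ W]

theorem cplxL_contDiff {G : Type*} [NormedAddCommGroup G] [NormedSpace ℂ G] [NormedSpace ℝ G]
    [IsScalarTower ℝ ℂ G] {s : Coord n → G} {U : Set (Coord n)}
    (hU : IsOpen U) (hs : ContDiffOn ℝ ∞ s U) : ContDiffOn ℝ ∞ (fun y ↦ cplx (fderiv ℝ s y)) U :=
  (cplxL (n := n) (F := G)).contDiff.comp_contDiffOn (hs.fderiv_of_isOpen hU (m := ∞) (by simp))

theorem linear_contDiff {F₁ G : Type*} [NormedAddCommGroup F₁] [NormedSpace ℂ F₁] [NormedSpace ℝ F₁]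
    [IsScalarTower ℝ ℂ F₁] [NormedAddCommGroup G] [NormedSpace ℂ G] [NormedSpace ℝ G]
    [IsScalarTower ℝ ℂ G] (B : F₁ →L[ℂ] G) {g : Coord n → F₁} {U : Set (Coord n)}
    (h : ContDiffOn ℝ ∞ g U) : ContDiffOn ℝ ∞ (fun y ↦ B (g y)) U :=
  (B.restrictScalars ℝ).contDiff.comp_contDiffOn h

theorem bilin_contDiff {F₁ F₂ G : Type*} [NormedAddCommGroup F₁] [NormedSpace ℂ F₁] [NormedSpace ℝ F₁]
    [IsScalarTower ℝ ℂ F₁] [NormedAddCommGroup F₂] [NormedSpace ℂ F₂] [NormedSpace ℝ F₂]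
    [IsScalarTower ℝ ℂ F₂] [NormedAddCommGroup G] [NormedSpace ℂ G] [NormedSpace ℝ G]
    [IsScalarTower ℝ ℂ G] (B : F₁ →L[ℂ] F₂ →L[ℂ] G) {g₁ : Coord n → F₁} {g₂ : Coord n → F₂}
    {U : Set (Coord n)} (h₁ : ContDiffOn ℝ ∞ g₁ U) (h₂ : ContDiffOn ℝ ∞ g₂ U) :
    ContDiffOn ℝ ∞ (fun y ↦ B (g₁ y) (g₂ y)) U :=
  (B.isBoundedBilinearMap.contDiff.restrict_scalars ℝ).comp_contDiffOn (h₁.prodMk h₂)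

theorem connD_contDiff {R : Coord n → W →L[ℂ] Coord n × Coord n} {c : Coord n → W →L[ℂ] W →L[ℂ] W}
    {s : Coord n → W [⋀^Fin k]→L[ℂ] ℂ} {U : Set (Coord n)} (hU : IsOpen U)
    (hs : ContDiffOn ℝ ∞ s U) (hR : ContDiffOn ℝ ∞ R U) (hc : ContDiffOn ℝ ∞ c U) :
    ContDiffOn ℝ ∞ (fun z ↦ connD (R z) (c z) s z) U := by
  have h1 := bilin_contDiff (ContinuousLinearMap.compL ℂ W (Coord n × Coord n) (W [⋀^Fin k]→L[ℂ] ℂ))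
    (cplxL_contDiff hU hs) hR
  have h2 := bilin_contDiff (ContinuousLinearMap.compL ℂ W (W →L[ℂ] W) (W [⋀^Fin k]→L[ℂ] ℂ))
    (linear_contDiff (actL (W := W) (k := k)) hs) hc
  exact linear_contDiff (ContinuousAlternatingMap.alternatizeUncurryFinCLM ℂ W ℂ)
    (h1.sub (h2.const_smul (1 / 2 : ℂ)))

theorem connD_section {fr : OpenPartialHomeomorph X (Coord n) → OpenPartialHomeomorph X (Coord n) →
      Coord n → W →L[ℂ] W} {s : atlas (Coord n) X → Coord n → W [⋀^Fin k]→L[ℂ] ℂ}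
    (hs : s ∈ sections X fr k)
    {R : atlas (Coord n) X → Coord n → W →L[ℂ] Coord n × Coord n}
    {c : atlas (Coord n) X → Coord n → W →L[ℂ] W →L[ℂ] W}
    (hR : ∀ e, ContDiffOn ℝ ∞ (R e) e.1.target) (hc : ∀ e, ContDiffOn ℝ ∞ (c e) e.1.target)
    (hanti : ∀ e z a b, c e z a b = - c e z b a)
    (hcomp : ∀ e e' : atlas (Coord n) X, ∀ z ∈ (e.1.symm.trans e'.1).source,
      DifferentiableAt ℝ (fr e e') z ∧
      (∀ a, R e' (e'.1 (e.1.symm z)) (fr e e' z a) =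
        (jac e.1 e'.1 z).prodMap (conjL (jac e.1 e'.1 z)) (R e z a)) ∧
      ∀ a b, cplx (fderiv ℝ (fr e e') z) (R e z a) b - cplx (fderiv ℝ (fr e e') z) (R e z b) a =
        fr e e' z (c e z a b) -
          c e' (e'.1 (e.1.symm z)) (fr e e' z a) (fr e e' z b)) :
    (fun e ↦ e.1.target.indicator fun z ↦ connD (R e z) (c e z) (s e) z) ∈
      sections X fr (k + 1) := by
  obtain ⟨-, h2, h3⟩ := hs
  refine ⟨fun e z hz ↦ Set.indicator_of_notMem hz _, fun e ↦ ?_, fun e e' z hz ↦ ?_⟩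
  · exact (connD_contDiff e.1.open_target (h2 e) (hR e) (hc e)).congr
      fun z hz ↦ Set.indicator_of_mem hz _
  · have hz1 := overlap_mem hz
    have hz2 : e'.1 (e.1.symm z) ∈ e'.1.target := e'.1.map_source hz1.2
    beta_reduce
    rw [Set.indicator_of_mem hz1.1, Set.indicator_of_mem hz2]
    obtain ⟨q1, q2, q3⟩ := hcomp e e' z hz
    have hev : s e =ᶠ[𝓝 z] fun y ↦
        (s e' ((e'.1 ∘ e.1.symm) y)).compContinuousLinearMap (fr e e' y) := by
      filter_upwards [overlap_nhds hz] with y hy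
      exact h3 e e' y hy
    have hcong : connD (R e z) (c e z) (s e) z = connD (R e z) (c e z) (fun y ↦
        (s e' ((e'.1 ∘ e.1.symm) y)).compContinuousLinearMap (fr e e' y)) z := by
      unfold connD
      rw [hev.fderiv_eq, hev.eq_of_nhds]
    rw [hcong]
    refine connD_pullback ?_ ((transition_contDiffAt e.2 e'.2 hz).differentiableAt (by simp)) q1
      q2 (hanti e z) (hanti e' _) q3
    exact ((h2 e').contDiffAt (e'.1.open_target.mem_nhds hz2)).differentiableAt (by simp)

section Compat
variable {e e' : OpenPartialHomeomorph X (Coord n)} {z : Coord n}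

theorem formFrame_diff
    (he : e ∈ atlas (Coord n) X) (he' : e' ∈ atlas (Coord n) X)
    (hz : z ∈ (e.symm.trans e').source) : DifferentiableAt ℝ (formFrame e e') z ∧
    ∀ u b, cplx (fderiv ℝ (formFrame e e') z) u b =
      (fderiv ℂ (jac e e') z u.1 b.1, star (fderiv ℂ (jac e e') z (star u.2) (star b.2))) :=
  prodMap_diff he he' hz ((jac_contDiffAt he he' hz).differentiableAt (by simp))

theorem polyFrame_diff
    (he : e ∈ atlas (Coord n) X) (he' : e' ∈ atlas (Coord n) X)
    (hz : z ∈ (e.symm.trans e').source) : DifferentiableAt ℝ (polyFrame e e') z ∧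
    ∀ u b, cplx (fderiv ℝ (polyFrame e e') z) u b =
      (b.1.comp (fderiv ℂ (jac e' e) (e' (e.symm z)) (jac e e' z u.1)),
        star (fderiv ℂ (jac e e') z (star u.2) (star b.2))) := by
  have hJ := (jac_contDiffAt he' he (overlap_symm hz).1).differentiableAt (by simp)
  have hf := (transition_contDiffAt he he' hz).differentiableAt (by simp)
  have h1 := (ContinuousLinearMap.compL ℂ (Coord n) (Coord n) ℂ).flip.hasFDerivAt.comp z
    (hJ.hasFDerivAt.comp z hf.hasFDerivAt)
  have h2 := prodMap_diff he he' hz h1.differentiableAt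
  refine ⟨h2.1, fun u b ↦ (h2.2 u b).trans ?_⟩
  rw [h1.fderiv]
  rfl

theorem form_compat_del
    (he : e ∈ atlas (Coord n) X) (he' : e' ∈ atlas (Coord n) X)
    (hz : z ∈ (e.symm.trans e').source) :
    DifferentiableAt ℝ (formFrame e e') z ∧
      (∀ a, ((ContinuousLinearMap.inl ℂ (Coord n) (Coord n)).comp
          (ContinuousLinearMap.fst ℂ (Coord n) (Coord n))) (formFrame e e' z a) =
        (jac e e' z).prodMap (conjL (jac e e' z)) ((ContinuousLinearMap.inl ℂ (Coord n) (Coord n)).comp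
          (ContinuousLinearMap.fst ℂ (Coord n) (Coord n)) a)) ∧
      ∀ a b, cplx (fderiv ℝ (formFrame e e') z) ((ContinuousLinearMap.inl ℂ (Coord n) (Coord n)).comp
          (ContinuousLinearMap.fst ℂ (Coord n) (Coord n)) a) b -
        cplx (fderiv ℝ (formFrame e e') z) ((ContinuousLinearMap.inl ℂ (Coord n) (Coord n)).comp
          (ContinuousLinearMap.fst ℂ (Coord n) (Coord n)) b) a = 0 := by
  obtain ⟨h1, h2⟩ := formFrame_diff he he' hz
  refine ⟨h1, fun a ↦ by simp [formFrame], fun a b ↦ ?_⟩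
  rw [h2, h2]
  simp [jac_symm he he' hz a.1]

theorem form_compat_dbar
    (he : e ∈ atlas (Coord n) X) (he' : e' ∈ atlas (Coord n) X)
    (hz : z ∈ (e.symm.trans e').source) :
    DifferentiableAt ℝ (formFrame e e') z ∧
      (∀ a, ((ContinuousLinearMap.inr ℂ (Coord n) (Coord n)).comp
          (ContinuousLinearMap.snd ℂ (Coord n) (Coord n))) (formFrame e e' z a) =
        (jac e e' z).prodMap (conjL (jac e e' z)) ((ContinuousLinearMap.inr ℂ (Coord n) (Coord n)).comp
          (ContinuousLinearMap.snd ℂ (Coord n) (Coord n)) a)) ∧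
      ∀ a b, cplx (fderiv ℝ (formFrame e e') z) ((ContinuousLinearMap.inr ℂ (Coord n) (Coord n)).comp
          (ContinuousLinearMap.snd ℂ (Coord n) (Coord n)) a) b -
        cplx (fderiv ℝ (formFrame e e') z) ((ContinuousLinearMap.inr ℂ (Coord n) (Coord n)).comp
          (ContinuousLinearMap.snd ℂ (Coord n) (Coord n)) b) a = 0 := by
  obtain ⟨h1, h2⟩ := formFrame_diff he he' hz
  refine ⟨h1, fun a ↦ by simp [formFrame], fun a b ↦ ?_⟩
  rw [h2, h2]
  simp [jac_symm he he' hz (star a.2)]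

theorem poly_compat_dbar
    (he : e ∈ atlas (Coord n) X) (he' : e' ∈ atlas (Coord n) X)
    (hz : z ∈ (e.symm.trans e').source) :
    DifferentiableAt ℝ (polyFrame e e') z ∧
      (∀ a, ((ContinuousLinearMap.inr ℂ (Coord n) (Coord n)).comp
          (ContinuousLinearMap.snd ℂ (Coord n →L[ℂ] ℂ) (Coord n))) (polyFrame e e' z a) =
        (jac e e' z).prodMap (conjL (jac e e' z)) ((ContinuousLinearMap.inr ℂ (Coord n) (Coord n)).comp
          (ContinuousLinearMap.snd ℂ (Coord n →L[ℂ] ℂ) (Coord n)) a)) ∧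
      ∀ a b, cplx (fderiv ℝ (polyFrame e e') z) ((ContinuousLinearMap.inr ℂ (Coord n) (Coord n)).comp
          (ContinuousLinearMap.snd ℂ (Coord n →L[ℂ] ℂ) (Coord n)) a) b -
        cplx (fderiv ℝ (polyFrame e e') z) ((ContinuousLinearMap.inr ℂ (Coord n) (Coord n)).comp
          (ContinuousLinearMap.snd ℂ (Coord n →L[ℂ] ℂ) (Coord n)) b) a = 0 := by
  obtain ⟨h1, h2⟩ := polyFrame_diff he he' hz
  refine ⟨h1, fun a ↦ by simp [polyFrame], fun a b ↦ ?_⟩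
  rw [h2, h2]
  simp [jac_symm he he' hz (star a.2)]

theorem lam_pullback
    (he : e ∈ atlas (Coord n) X) (he' : e' ∈ atlas (Coord n) X)
    (hz : z ∈ (e.symm.trans e').source) {σ σ' : Biv n} (h : σ = σ'.compContinuousLinearMap (polyFrame e e' z))
    (a b : Lbar n) : lamL n σ a b = lamL n σ' (polyFrame e e' z a) (polyFrame e e' z b) := by
  rw [lamL_apply, lamL_apply, h, ContinuousAlternatingMap.compContinuousLinearMap_apply]
  refine congrArg σ' (funext fun i ↦ ?_)
  fin_cases i <;> simp [polyFrame]

theorem sharp_pullback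
    (he : e ∈ atlas (Coord n) X) (he' : e' ∈ atlas (Coord n) X)
    (hz : z ∈ (e.symm.trans e').source) {σ σ' : Biv n} (h : σ = σ'.compContinuousLinearMap (polyFrame e e' z))
    (a : Lbar n) : sharpL n σ' (polyFrame e e' z a) = jac e e' z (sharpL n σ a) := by
  funext j
  let ξ := (ContinuousLinearMap.proj (R := ℂ) (φ := fun _ : Fin n ↦ ℂ) j)
  change ξ (sharpL n σ' (polyFrame e e' z a)) = (ξ.comp (jac e e' z)) (sharpL n σ a)
  have h1 := sharpL_apply σ' (polyFrame e e' z a) (ξ, 0)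
  have h2 := sharpL_apply σ a (ξ.comp (jac e e' z), 0)
  rw [lam_pullback he he' hz h] at h2
  refine h1.trans (Eq.trans (lamL_congr _ rfl ?_) h2.symm)
  refine ContinuousLinearMap.ext fun v ↦ ?_
  change ξ v = ξ (jac e e' z (jac e' e (e' (e.symm z)) v))
  rw [← Function.comp_apply (f := e') (g := e.symm), jac_jac' he he' hz]

theorem poly_compat_schouten
    (he : e ∈ atlas (Coord n) X) (he' : e' ∈ atlas (Coord n) X)
    (hz : z ∈ (e.symm.trans e').source) {Λ Λ' : Coord n → Biv n} (hd : DifferentiableAt ℝ Λ z)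
    (hd' : DifferentiableAt ℝ Λ' (e' (e.symm z)))
    (h : ∀ y ∈ (e.symm.trans e').source,
      Λ y = (Λ' (e' (e.symm y))).compContinuousLinearMap (polyFrame e e' y)) :
    DifferentiableAt ℝ (polyFrame e e') z ∧
      (∀ a, ((ContinuousLinearMap.inl ℂ (Coord n) (Coord n)).comp
          (sharp Λ' (e' (e.symm z)))) (polyFrame e e' z a) =
        (jac e e' z).prodMap (conjL (jac e e' z))
          ((ContinuousLinearMap.inl ℂ (Coord n) (Coord n)).comp (sharp Λ z) a)) ∧
      ∀ a b, cplx (fderiv ℝ (polyFrame e e') z)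
          ((ContinuousLinearMap.inl ℂ (Coord n) (Coord n)).comp (sharp Λ z) a) b -
        cplx (fderiv ℝ (polyFrame e e') z)
          ((ContinuousLinearMap.inl ℂ (Coord n) (Coord n)).comp (sharp Λ z) b) a =
        polyFrame e e' z (brack Λ z a b) -
          brack Λ' (e' (e.symm z)) (polyFrame e e' z a) (polyFrame e e' z b) := by
  obtain ⟨h1, h2⟩ := polyFrame_diff he he' hz
  have hsh (a) := sharp_pullback he he' hz (h z hz) a
  refine ⟨h1, fun a ↦ by simp [sharp_eq, hsh], fun a b ↦ ?_⟩
  have hf := (transition_contDiffAt he he' hz).differentiableAt (by simp)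
  have hG (u v) := jac_symm he' he (overlap_symm hz).1 u v
  rw [h2, h2, brack_eq hd, brack_eq hd', sharp_eq]
  set f := e' ∘ e.symm with hfdef
  change DifferentiableAt ℝ Λ' (f z) at hd'
  set G := fderiv ℂ (jac e' e) (f z) with hGdef
  have hG' : fderiv ℂ (jac e' e) (e' (e.symm z)) = G := rfl
  rw [hG']
  refine Prod.ext (ContinuousLinearMap.ext fun v ↦ ?_) ?_
  swap
  · simp [brackL_snd, polyFrame]
  set u := jac e' e (f z) v with hu
  have hJu : jac e e' z u = v := jac_jac' he he' hz v
  -- differentiate the transformation rule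
  have hLf : DifferentiableAt ℝ (fun y ↦ Λ' (f y)) z :=
    hd'.comp z (hf.restrictScalars ℝ)
  have hLf' : cplx (fderiv ℝ (fun y ↦ Λ' (f y)) z) (u, 0) = cplx (fderiv ℝ Λ' (f z)) (v, 0) := by
    have e1 : fderiv ℝ (fun y ↦ Λ' (f y)) z =
        (fderiv ℝ Λ' (f z)).comp ((fderiv ℂ f z).restrictScalars ℝ) :=
      (hd'.hasFDerivAt.comp z (hf.hasFDerivAt.restrictScalars ℝ)).fderiv
    rw [e1, cplx_comp_holo]
    change cplx (fderiv ℝ Λ' (f z)) (jac e e' z u, conjL (jac e e' z) 0) = _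
    rw [hJu, map_zero]
  have hT (a : Lbar n) : DifferentiableAt ℝ (fun y ↦ polyFrame e e' y a) z ∧
      cplx (fderiv ℝ (fun y ↦ polyFrame e e' y a) z) (u, 0) = (a.1.comp (G v), 0) := by
    have e1 := cplx_linear (ContinuousLinearMap.apply ℂ (Lbar n) a) h1
    refine ⟨(((ContinuousLinearMap.apply ℂ (Lbar n) a).restrictScalars ℝ).hasFDerivAt.comp z
      h1.hasFDerivAt).differentiableAt, ?_⟩
    refine (congrArg (fun L ↦ L (u, 0)) e1).trans ?_
    change cplx (fderiv ℝ (polyFrame e e') z) (u, 0) a = _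
    rw [h2, hJu]
    simp [hG']
  have l1 := cplx_bilin (lamL n) hLf (hT a).1
  have l2 := cplx_bilin (ContinuousLinearMap.id ℂ (Lbar n →L[ℂ] ℂ)) l1.1 (hT b).1
  have l3 : (fun y ↦ lamL n (Λ' (f y)) (polyFrame e e' y a) (polyFrame e e' y b)) =ᶠ[𝓝 z]
      fun y ↦ ((ContinuousLinearMap.apply ℂ ℂ b).comp
        ((ContinuousLinearMap.apply ℂ _ a).comp (lamL n))) (Λ y) := by
    filter_upwards [overlap_nhds hz] with y hy
    exact (lam_pullback he he' hy (h y hy) a b).symm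
  have l4 := l2.2 (u, 0)
  rw [l1.2, (hT a).2, (hT b).2, hLf'] at l4
  have l5 : cplx (fderiv ℝ (fun y ↦ lamL n (Λ' (f y)) (polyFrame e e' y a) (polyFrame e e' y b)) z)
      (u, 0) = lamL n (cplx (fderiv ℝ Λ z) (u, 0)) a b := by
    rw [l3.fderiv_eq, cplx_linear _ hd]
    rfl
  have l6 := l5.symm.trans l4
  have l7 : lamL n (Λ' (f z)) (polyFrame e e' z a) (b.1.comp (G v), 0) =
      b.1 (G v (jac e e' z (sharpL n (Λ z) a))) := by
    rw [← sharpL_apply, ← hsh]; rfl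
  have l8 : lamL n (Λ' (f z)) (a.1.comp (G v), 0) (polyFrame e e' z b) =
      - a.1 (G v (jac e e' z (sharpL n (Λ z) b))) := by
    rw [lamL_anti, ← sharpL_apply, ← hsh]; rfl
  have l9 : (polyFrame e e' z (brackL n (cplx (fderiv ℝ Λ z)) a b)).1 v =
      lamL n (cplx (fderiv ℝ Λ z) (u, 0)) a b := by
    rw [← brackL_fst]; rfl
  change b.1 (G (jac e e' z (sharpL n (Λ z) a)) v) - a.1 (G (jac e e' z (sharpL n (Λ z) b)) v) =
    (polyFrame e e' z (brackL n (cplx (fderiv ℝ Λ z)) a b)).1 v -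
      (brackL n (cplx (fderiv ℝ Λ' (f z))) (polyFrame e e' z a) (polyFrame e e' z b)).1 v
  rw [l9, brackL_fst, l6, hG _ v, hG _ v, ← l7, ← neg_neg (a.1 _), ← l8]
  simp only [ContinuousLinearMap.id_apply, _root_.add_apply]
  ring

end Compat

end Manifold

end

/-! ### Global operators -/

section
variable {n k : ℕ}
section Global
open Filter Topology

variable {X : Type*} [TopologicalSpace X] [ChartedSpace (Coord n) X]

section
variable {W : Type*} [NormedAddCommGroup W] [NormedSpace ℂ W]

theorem connD_add (R : W →L[ℂ] Coord n × Coord n) (c : W →L[ℂ] W →L[ℂ] W)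
    {s t : Coord n → W [⋀^Fin k]→L[ℂ] ℂ} {z : Coord n} (hs : DifferentiableAt ℝ s z)
    (ht : DifferentiableAt ℝ t z) : connD R c (s + t) z = connD R c s z + connD R c t z := by
  rw [connD_nabla, connD_nabla, connD_nabla, ← map_add, nabla, nabla, nabla, fderiv_add hs ht,
    cplx_add, Pi.add_apply]
  congr 1
  simp only [map_add, _root_.add_apply, smul_add]
  abel

theorem connD_smul (R : W →L[ℂ] Coord n × Coord n) (c : W →L[ℂ] W →L[ℂ] W) (a : ℂ)
    {s : Coord n → W [⋀^Fin k]→L[ℂ] ℂ} {z : Coord n} (hs : DifferentiableAt ℝ s z) :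
    connD R c (a • s) z = a • connD R c s z := by
  rw [connD_nabla, connD_nabla, ← map_smul, nabla, nabla, fderiv_const_smul hs, Pi.smul_apply]
  congr 1
  have : cplx (a • fderiv ℝ s z) = a • cplx (fderiv ℝ s z) := by
    refine ContinuousLinearMap.ext fun u ↦ ?_
    simp only [cplx_apply, _root_.smul_apply]
    module
  rw [this]
  simp only [map_smul, _root_.smul_apply, smul_sub]
  congr 1
  exact smul_comm _ _ _

variable {fr : OpenPartialHomeomorph X (Coord n) → OpenPartialHomeomorph X (Coord n) →
      Coord n → W →L[ℂ] W}

theorem section_diff (s : sections X fr k) {e : atlas (Coord n) X} {z : Coord n}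
    (hz : z ∈ e.1.target) : ContDiffAt ℝ ∞ (s.1 e) z :=
  (s.2.2.1 e).contDiffAt (e.1.open_target.mem_nhds hz)

/-- The operator on sections with local expressions `Q e`. -/
def globalize (Q : atlas (Coord n) X → (Coord n → W [⋀^Fin k]→L[ℂ] ℂ) → Coord n →
      W [⋀^Fin (k + 1)]→L[ℂ] ℂ)
    (hQ : ∀ s : sections X fr k, (fun e ↦ e.1.target.indicator (Q e (s.1 e))) ∈
      sections X fr (k + 1))
    (hadd : ∀ (s t : sections X fr k) (e) (z), z ∈ e.1.target →
      Q e (s.1 e + t.1 e) z = Q e (s.1 e) z + Q e (t.1 e) z)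
    (hsmul : ∀ (a : ℂ) (s : sections X fr k) (e) (z), z ∈ e.1.target →
      Q e (a • s.1 e) z = a • Q e (s.1 e) z) :
    sections X fr k →ₗ[ℂ] sections X fr (k + 1) where
  toFun s := ⟨fun e ↦ e.1.target.indicator (Q e (s.1 e)), hQ s⟩
  map_add' s t := by
    refine Subtype.ext (funext fun e ↦ funext fun z ↦ ?_)
    change e.1.target.indicator (Q e (s.1 e + t.1 e)) z =
      e.1.target.indicator (Q e (s.1 e)) z + e.1.target.indicator (Q e (t.1 e)) z
    by_cases hz : z ∈ e.1.target
    · simp only [Set.indicator_of_mem hz, hadd s t e z hz]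
    · simp only [Set.indicator_of_notMem hz, add_zero]
  map_smul' a s := by
    refine Subtype.ext (funext fun e ↦ funext fun z ↦ ?_)
    change e.1.target.indicator (Q e (a • s.1 e)) z = a • e.1.target.indicator (Q e (s.1 e)) z
    by_cases hz : z ∈ e.1.target
    · simp only [Set.indicator_of_mem hz, hsmul a s e z hz]
    · simp only [Set.indicator_of_notMem hz, smul_zero]

end

variable [IsManifold 𝓘(ℂ, Coord n) ω X]

theorem delLocal_mem (s : Forms n X k) :
    (fun e : atlas (Coord n) X ↦ e.1.target.indicator (delLocal (s.1 e))) ∈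
      sections X formFrame (k + 1) := by
  have h := connD_section s.2
    (R := fun _ _ ↦ (ContinuousLinearMap.inl ℂ _ _).comp (ContinuousLinearMap.fst ℂ _ _))
    (c := fun _ _ ↦ 0) (fun _ ↦ contDiffOn_const) (fun _ ↦ contDiffOn_const) (by simp)
    (fun e e' z hz ↦ by simpa using form_compat_del e.2 e'.2 hz)
  simpa only [← delLocal_eq] using h

theorem dbarForms_mem (s : Forms n X k) :
    (fun e : atlas (Coord n) X ↦ e.1.target.indicator (dbarLocal (s.1 e))) ∈
      sections X formFrame (k + 1) := by
  have h := connD_section s.2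
    (R := fun _ _ ↦ (ContinuousLinearMap.inr ℂ _ _).comp (ContinuousLinearMap.snd ℂ _ _))
    (c := fun _ _ ↦ 0) (fun _ ↦ contDiffOn_const) (fun _ ↦ contDiffOn_const) (by simp)
    (fun e e' z hz ↦ by simpa using form_compat_dbar e.2 e'.2 hz)
  simpa only [← dbarLocal_eq] using h

theorem dbarPolyvectors_mem (s : Polyvectors n X k) :
    (fun e : atlas (Coord n) X ↦ e.1.target.indicator (dbarLocal (s.1 e))) ∈
      sections X polyFrame (k + 1) := by
  have h := connD_section s.2
    (R := fun _ _ ↦ (ContinuousLinearMap.inr ℂ _ _).comp (ContinuousLinearMap.snd ℂ _ _))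
    (c := fun _ _ ↦ 0) (fun _ ↦ contDiffOn_const) (fun _ ↦ contDiffOn_const) (by simp)
    (fun e e' z hz ↦ by simpa using poly_compat_dbar e.2 e'.2 hz)
  simpa only [← dbarLocal_eq] using h

theorem schoutenLocal_mem (Λ : Polyvectors n X 2) (s : Polyvectors n X k) :
    (fun e : atlas (Coord n) X ↦ e.1.target.indicator (schoutenLocal (Λ.1 e) (s.1 e))) ∈
      sections X polyFrame (k + 1) := by
  have hd (e : atlas (Coord n) X) {z : Coord n} (hz : z ∈ e.1.target) :
      DifferentiableAt ℝ (Λ.1 e) z := (section_diff Λ hz).differentiableAt (by simp)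
  have h := connD_section s.2
    (R := fun e z ↦ (ContinuousLinearMap.inl ℂ _ _).comp (sharp (Λ.1 e) z))
    (c := fun e z ↦ brack (Λ.1 e) z) (fun e ↦ ?_) (fun e ↦ ?_) (fun e z ↦ brack_anti _ _)
    (fun e e' z hz ↦ poly_compat_schouten e.2 e'.2 hz (hd e (overlap_mem hz).1)
      (hd e' (e'.1.map_source (overlap_mem hz).2)) fun y hy ↦ Λ.2.2.2 e e' y hy)
  · simpa only [← schoutenLocal_eq] using h
  · simp only [sharp_eq]
    exact linear_contDiff ((ContinuousLinearMap.compL ℂ (Lbar n) (Coord n) (Coord n × Coord n)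
      (ContinuousLinearMap.inl ℂ _ _)).comp (sharpL n)) (Λ.2.2.1 e)
  · exact (linear_contDiff (brackL n) (cplxL_contDiff e.1.open_target (Λ.2.2.1 e))).congr
      fun z hz ↦ brack_eq (hd e hz)

/-- The operator `∂` on differential forms. -/
def del (k : ℕ) : Forms n X k →ₗ[ℂ] Forms n X (k + 1) :=
  globalize (fun _ ↦ delLocal) delLocal_mem
    (fun s t e z hz ↦ by
      simp only [delLocal_eq]
      exact connD_add _ _ ((section_diff s hz).differentiableAt (by simp))
        ((section_diff t hz).differentiableAt (by simp)))
    (fun a s e z hz ↦ by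
      simp only [delLocal_eq]
      exact connD_smul _ _ a ((section_diff s hz).differentiableAt (by simp)))

/-- The operator `∂̄` on differential forms. -/
def dbarForms (k : ℕ) : Forms n X k →ₗ[ℂ] Forms n X (k + 1) :=
  globalize (fun _ ↦ dbarLocal) dbarForms_mem
    (fun s t e z hz ↦ by
      simp only [dbarLocal_eq]
      exact connD_add _ _ ((section_diff s hz).differentiableAt (by simp))
        ((section_diff t hz).differentiableAt (by simp)))
    (fun a s e z hz ↦ by
      simp only [dbarLocal_eq]
      exact connD_smul _ _ a ((section_diff s hz).differentiableAt (by simp)))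

/-- The operator `∂̄ : A^{p,q} → A^{p,q+1}`. -/
def dbarPolyvectors (k : ℕ) : Polyvectors n X k →ₗ[ℂ] Polyvectors n X (k + 1) :=
  globalize (fun _ ↦ dbarLocal) dbarPolyvectors_mem
    (fun s t e z hz ↦ by
      simp only [dbarLocal_eq]
      exact connD_add _ _ ((section_diff s hz).differentiableAt (by simp))
        ((section_diff t hz).differentiableAt (by simp)))
    (fun a s e z hz ↦ by
      simp only [dbarLocal_eq]
      exact connD_smul _ _ a ((section_diff s hz).differentiableAt (by simp)))

/-- The operator `ad_Λ = [Λ, ·] : A^{p,q} → A^{p+1,q}`, for a bivector field `Λ`. -/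
def schouten (Λ : Polyvectors n X 2) (k : ℕ) : Polyvectors n X k →ₗ[ℂ] Polyvectors n X (k + 1) :=
  globalize (fun e ↦ schoutenLocal (Λ.1 e)) (schoutenLocal_mem Λ)
    (fun s t e z hz ↦ by
      simp only [schoutenLocal_eq]
      exact connD_add _ _ ((section_diff s hz).differentiableAt (by simp))
        ((section_diff t hz).differentiableAt (by simp)))
    (fun a s e z hz ↦ by
      simp only [schoutenLocal_eq]
      exact connD_smul _ _ a ((section_diff s hz).differentiableAt (by simp)))

/-- The exterior derivative `d = ∂ + ∂̄`, the total differential of the double complex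
`(B^{p,q}, ∂, ∂̄)`. -/
def exteriorD (k : ℕ) : Forms n X k →ₗ[ℂ] Forms n X (k + 1) := del k + dbarForms k

theorem exteriorD_exteriorD (k : ℕ) (s : Forms n X k) : exteriorD (k + 1) (exteriorD k s) = 0 := by
  have key {k : ℕ} (s : Forms n X k) (e : atlas (Coord n) X) {z : Coord n} (hz : z ∈ e.1.target) :
      (exteriorD k s).1 e z = connD (.id ℂ _) 0 (s.1 e) z := by
    change e.1.target.indicator (delLocal (s.1 e)) z +
      e.1.target.indicator (dbarLocal (s.1 e)) z = _
    rw [Set.indicator_of_mem hz, Set.indicator_of_mem hz, delLocal_eq, dbarLocal_eq, connD_nabla,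
      connD_nabla, connD_nabla, ← map_add]
    congr 1
    refine ContinuousLinearMap.ext fun a ↦ ?_
    rw [_root_.add_apply, nabla_apply, nabla_apply, nabla_apply]
    simp only [_root_.zero_apply, map_zero, smul_zero, sub_zero, ← map_add]
    simp
  refine Subtype.ext (funext fun e ↦ funext fun z ↦ ?_)
  by_cases hz : z ∈ e.1.target
  · rw [key _ e hz]
    have hev : (exteriorD k s).1 e =ᶠ[𝓝 z] fun y ↦ connD (.id ℂ _) 0 (s.1 e) y := by
      filter_upwards [e.1.open_target.mem_nhds hz] with y hy
      exact key s e hy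
    have := connD_connD (R := fun _ ↦ .id ℂ (Coord n × Coord n)) (c := fun _ ↦ 0)
      (section_diff s hz) (differentiableAt_const _) (differentiableAt_const _)
      (by simp) (by simp [cplx_apply]) (by simp [cplx_apply])
    unfold connD at this ⊢
    rw [hev.fderiv_eq, hev.eq_of_nhds]
    exact this
  · exact (exteriorD (k + 1) (exteriorD k s)).2.1 e z hz

variable (n X) in
/-- A holomorphic Poisson structure: a holomorphic bivector field `Λ` with `[Λ, Λ] = 0`. -/
structure PoissonStructure where
  /-- the bivector field `Λ` -/
  bivector : Polyvectors n X 2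
  bivector_mem : bivector ∈ pureType polyFrame 2 2
  holomorphic : dbarPolyvectors 2 bivector = 0
  schouten_self : schouten bivector 2 bivector = 0

/-- The total differential `D = ∂̄ + ad_Λ` of the double complex `(A^{p,q}, ad_Λ, ∂̄)`. -/
def totalD (Λ : PoissonStructure n X) (k : ℕ) : Polyvectors n X k →ₗ[ℂ] Polyvectors n X (k + 1) :=
  dbarPolyvectors k + schouten Λ.bivector k

theorem totalD_totalD (Λ : PoissonStructure n X) (k : ℕ) (s : Polyvectors n X k) :
    totalD Λ (k + 1) (totalD Λ k s) = 0 := by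
  have key {k : ℕ} (s : Polyvectors n X k) (e : atlas (Coord n) X) {z : Coord n}
      (hz : z ∈ e.1.target) : (totalD Λ k s).1 e z =
        connD (anchorP (Λ.bivector.1 e z)) (brackL n (cplx (fderiv ℝ (Λ.bivector.1 e) z)))
          (s.1 e) z := by
    change e.1.target.indicator (dbarLocal (s.1 e)) z +
      e.1.target.indicator (schoutenLocal (Λ.bivector.1 e) (s.1 e)) z = _
    rw [Set.indicator_of_mem hz, Set.indicator_of_mem hz]
    exact dbar_add_schouten ((section_diff Λ.bivector hz).differentiableAt (by simp)) _
  refine Subtype.ext (funext fun e ↦ funext fun z ↦ ?_)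
  by_cases hz : z ∈ e.1.target
  · rw [key _ e hz]
    have hnear := e.1.open_target.mem_nhds hz
    have hev : (totalD Λ k s).1 e =ᶠ[𝓝 z] fun y ↦
        connD (anchorP (Λ.bivector.1 e y)) (brackL n (cplx (fderiv ℝ (Λ.bivector.1 e) y)))
          (s.1 e) y := by
      filter_upwards [hnear] with y hy
      exact key s e hy
    have := poisson_square (section_diff Λ.bivector hz)
      (by
        filter_upwards [hnear] with y hy
        have := congrArg (fun t ↦ t.1 e y) Λ.holomorphic
        exact (Set.indicator_of_mem hy _).symm.trans this)
      (by
        filter_upwards [hnear] with y hy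
        have := congrArg (fun t ↦ t.1 e y) Λ.schouten_self
        exact (Set.indicator_of_mem hy _).symm.trans this)
      (section_diff s hz)
    unfold connD at this ⊢
    rw [hev.fderiv_eq, hev.eq_of_nhds]
    exact this
  · exact (totalD Λ (k + 1) (totalD Λ k s)).2.1 e z hz

end Global

end

end HolomorphicPoisson

end

/-!
# Degeneration of the spectral sequence of the holomorphic Poisson double complex

Polyvector fields of type `(p, q)` vanish unless `0 ≤ p ≤ n`, so among the differentials `d_r` with
`r ≥ n` only the `d_n` which start in the column `p = 0` can be nonzero (for `n = 0` everything in
positive degree vanishes).  These vanish because classes in the column `p = 0`, which are classes in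
`H^q(X, 𝒪)`, can be represented by `D`-closed elements.

To see this, regard `T^{*(1,0)} ⊕ T^{0,1}` with anchor `Λ^♯ ⊕ id` as a Lie algebroid.  The pullback
along the anchor is a morphism `Φ` from the complex of differential forms with `d = ∂ + ∂̄` to the
complex of polyvector fields with `D = ∂̄ + ad_Λ` (`totalD_pullback_anchor`); it respects `F^1`, and
it is the identity on `(0, q)`-forms, which occur in both complexes.  A `∂̄`-closed `(0, q)`-form `φ`
extends, by the degeneration of the Frölicher spectral sequence, to a `d`-closed form `φ - y` with
`y` in `F^1` (`DegeneratesAt.exists_sub_mem`), and `Φ (φ - y)` is a `D`-closed polyvector field with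
the same `(0, q)`-part (`exists_mem_filtration_one_totalD_eq`).

The filtration is defined by sums of spaces of pure type.  That sections are the sums of their parts
of pure type, and that `F^1` consists of the sections which vanish on antiholomorphic tangent
vectors (`mem_filtration_one_iff`), is shown by recovering the parts of a section from its pullbacks
along the maps `(v, w) ↦ (t v, w)`.
-/

noncomputable section
namespace HolomorphicPoisson

attribute [local instance 2000] NormedSpace.toModule AddCommGroup.toAddCommMonoid
  SeminormedAddCommGroup.toAddCommGroup NormedAddCommGroup.toSeminormedAddCommGroup
  UniformSpace.toTopologicalSpace PseudoMetricSpace.toUniformSpace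
  SeminormedAddCommGroup.toPseudoMetricSpace

/-! ### Degeneration of the spectral sequence of a filtered complex -/

section SpectralSequence

variable {K : ℕ → Type*} [∀ k, AddCommGroup (K k)] [∀ k, Module ℂ (K k)]
  {D : ∀ k, K k →ₗ[ℂ] K (k + 1)} (hD : ∀ k x, D (k + 1) (D k x) = 0)
  {F : ℤ → ∀ k, Submodule ℂ (K k)}

theorem pageDifferential_eq_zero_iff (r p : ℤ) (k : ℕ) :
    pageDifferential hD F r p k = 0 ↔
      ∀ x ∈ F p k, D k x ∈ F (p + r) (k + 1) → D k x ∈ boundaries D F r (p + r) (k + 1) := by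
  constructor
  · intro h x hx hDx
    have h1 := congrArg (fun L ↦ L (Submodule.Quotient.mk ⟨x, hx, hDx⟩)) h
    exact (Submodule.Quotient.mk_eq_zero
      ((boundaries D F r (p + r) (k + 1)).submoduleOf (cycles D F r (p + r) (k + 1)))).1 h1
  · intro h
    refine LinearMap.ext fun q ↦ ?_
    obtain ⟨⟨x, hx, hDx⟩, rfl⟩ := Submodule.Quotient.mk_surjective _ q
    exact (Submodule.Quotient.mk_eq_zero _).2 (h x hx hDx)

theorem apply_mem_boundaries {r p : ℤ} {k : ℕ} {x : K k} (hx : x ∈ F (p + 1) k)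
    (hDx : D k x ∈ F (p + r) (k + 1)) : D k x ∈ boundaries D F r (p + r) (k + 1) := by
  refine Submodule.mem_sup_right ⟨x, ⟨?_, ?_⟩, rfl⟩
  · rwa [add_sub_cancel_right]
  · change D k x ∈ F (p + r - r + 1 + (r - 1)) (k + 1)
    rwa [show p + r - r + 1 + (r - 1) = p + r by ring]

/-- If the spectral sequence degenerates at the `E_1` level, then every class of the first page
survives to all later pages: each representative can be corrected by terms of higher filtration so
that its differential lies arbitrarily deep in the filtration. -/
theorem DegeneratesAt.exists_sub_mem (hdeg : DegeneratesAt D hD F 1)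
    (hF : ∀ k, Antitone fun p ↦ F p k) {p : ℤ} {k : ℕ} {x : K k} (hx : x ∈ F p k)
    (hDx : D k x ∈ F (p + 1) (k + 1)) (m : ℕ) :
    ∃ y ∈ F (p + 1) k, D k (x - y) ∈ F (p + (m + 1 : ℕ)) (k + 1) := by
  induction m with
  | zero => exact ⟨0, zero_mem _, by simpa using hDx⟩
  | succ m ih =>
    obtain ⟨y, hy, hDy⟩ := ih
    have hxy : x - y ∈ F p k := sub_mem hx (hF k (by simp) hy)
    have h := (pageDifferential_eq_zero_iff hD _ p k).1 (hdeg (m + 1) (by simp) p k) _ hxy hDy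
    obtain ⟨u, hu, _, ⟨v, hv, rfl⟩, huv⟩ := Submodule.mem_sup.1 h
    refine ⟨y + v, add_mem hy ?_, ?_⟩
    · have := hv.1
      rwa [add_sub_cancel_right] at this
    · have h1 : D k (x - (y + v)) = u := by
        rw [← sub_sub, map_sub, ← huv, add_sub_cancel_right]
      rw [h1]
      have := hu.1
      rwa [add_assoc, ← Nat.cast_succ] at this

end SpectralSequence

/-! ### Smoothness of pullbacks of alternating forms -/

section Pullback

variable {k : ℕ} {W W' : Type*} [NormedAddCommGroup W] [NormedSpace ℂ W]
  [NormedAddCommGroup W'] [NormedSpace ℂ W']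

/-- The alternatization of multilinear forms as a continuous linear map. -/
def alternatizationL :
    ContinuousMultilinearMap ℂ (fun _ : Fin k ↦ W) ℂ →L[ℂ] W [⋀^Fin k]→L[ℂ] ℂ :=
  LinearMap.mkContinuous
    { toFun := ContinuousMultilinearMap.alternatization
      map_add' := map_add _
      map_smul' := fun a f ↦ by
        ext v
        simp [ContinuousMultilinearMap.alternatization_apply_apply, Finset.mul_sum,
          mul_smul_comm] }
    (Fintype.card (Equiv.Perm (Fin k))) fun f ↦ by
      refine ContinuousAlternatingMap.opNorm_le_bound _ (by positivity) fun v ↦ ?_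
      refine (congrArg _ (ContinuousMultilinearMap.alternatization_apply_apply f v)).trans_le ?_
      refine (norm_sum_le _ _).trans ?_
      have h (σ : Equiv.Perm (Fin k)) :
          ‖Equiv.Perm.sign σ • f (v ∘ σ)‖ ≤ ‖f‖ * ∏ i, ‖v i‖ := by
        have h1 : ‖Equiv.Perm.sign σ • f (v ∘ σ)‖ = ‖f (v ∘ σ)‖ := by
          rcases Int.units_eq_one_or (Equiv.Perm.sign σ) with h | h <;> simp [h]
        rw [h1]
        refine (f.le_opNorm _).trans_eq ?_
        congr 1
        exact Equiv.prod_comp σ fun i ↦ ‖v i‖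
      refine (Finset.sum_le_sum fun σ _ ↦ h σ).trans_eq ?_
      simp [mul_assoc]

theorem alternatizationL_coe (σ : W [⋀^Fin k]→L[ℂ] ℂ) :
    alternatizationL σ.toContinuousMultilinearMap = (Nat.factorial k : ℂ) • σ := by
  ext v
  change ContinuousMultilinearMap.alternatization _ v = _
  rw [ContinuousMultilinearMap.alternatization_apply_apply]
  have h (τ : Equiv.Perm (Fin k)) :
      Equiv.Perm.sign τ • σ.toContinuousMultilinearMap (v ∘ τ) = σ v := by
    refine (congrArg _ (σ.toAlternatingMap.map_perm v τ)).trans ?_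
    rw [smul_smul, Int.units_mul_self, one_smul]
    rfl
  rw [Finset.sum_congr rfl fun τ _ ↦ h τ]
  simp [Fintype.card_perm]

/-- Multilinear forms pull back by a continuous multilinear map of the linear maps; alternating back
recovers `k!` times the pullback of an alternating form. -/
theorem contDiffOn_compContinuousLinearMap {n : ℕ} {U : Set (Coord n)}
    {s : Coord n → W' [⋀^Fin k]→L[ℂ] ℂ} {T : Coord n → W →L[ℂ] W'} (hs : ContDiffOn ℝ ∞ s U)
    (hT : ContDiffOn ℝ ∞ T U) :
    ContDiffOn ℝ ∞ (fun z ↦ (s z).compContinuousLinearMap (T z)) U := by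
  let M := ContinuousMultilinearMap.compContinuousLinearMapContinuousMultilinear ℂ
    (fun _ : Fin k ↦ W) (fun _ ↦ W') ℂ
  have h1 : ContDiffOn ℝ ∞ (fun z ↦ M fun _ ↦ T z) U :=
    (M.contDiff.restrict_scalars ℝ).comp_contDiffOn (contDiffOn_pi.2 fun _ ↦ hT)
  have h2 : ContDiffOn ℝ ∞ (fun z ↦ (s z).toContinuousMultilinearMap) U :=
    ((ContinuousAlternatingMap.toContinuousMultilinearMapCLM ℂ :
      (W' [⋀^Fin k]→L[ℂ] ℂ) →L[ℂ] _).restrictScalars ℝ).contDiff.comp_contDiffOn hs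
  have h3 := linear_contDiff (alternatizationL (W := W) (k := k))
    (bilin_contDiff (ContinuousLinearMap.id ℂ _) h1 h2)
  refine (h3.const_smul ((Nat.factorial k : ℂ)⁻¹)).congr fun z _ ↦ ?_
  have h4 := alternatizationL_coe ((s z).compContinuousLinearMap (T z))
  have h5 : (Nat.factorial k : ℂ) ≠ 0 := by exact_mod_cast Nat.factorial_ne_zero k
  exact (eq_inv_smul_iff₀ h5).2 h4.symm

end Pullback

/-! ### Pullback of sections along bundle maps -/

section BundleMaps

variable {n : ℕ} {X : Type*} [TopologicalSpace X] [ChartedSpace (Coord n) X]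
  {W W' : Type*} [NormedAddCommGroup W] [NormedSpace ℂ W]
  [NormedAddCommGroup W'] [NormedSpace ℂ W']

/-- A smooth bundle map over `X` between the vector bundles with fibres `W`, `W'` and transition
functions `fr`, `fr'`, given by its local expressions in the charts of the atlas. -/
structure BundleMap (fr : OpenPartialHomeomorph X (Coord n) → OpenPartialHomeomorph X (Coord n) →
      Coord n → W →L[ℂ] W)
    (fr' : OpenPartialHomeomorph X (Coord n) → OpenPartialHomeomorph X (Coord n) →
      Coord n → W' →L[ℂ] W') where
  /-- the local expressions -/
  toFun : atlas (Coord n) X → Coord n → W →L[ℂ] W'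
  contDiffOn : ∀ e, ContDiffOn ℝ ∞ (toFun e) e.1.target
  comm : ∀ e e' : atlas (Coord n) X, ∀ z ∈ (e.1.symm.trans e'.1).source, ∀ a,
    toFun e' (e'.1 (e.1.symm z)) (fr e e' z a) = fr' e e' z (toFun e z a)

variable {fr : OpenPartialHomeomorph X (Coord n) → OpenPartialHomeomorph X (Coord n) →
      Coord n → W →L[ℂ] W}
    {fr' : OpenPartialHomeomorph X (Coord n) → OpenPartialHomeomorph X (Coord n) →
      Coord n → W' →L[ℂ] W'}

/-- The pullback of alternating forms along a bundle map. -/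
def pullback (T : BundleMap fr fr') (k : ℕ) : sections X fr' k →ₗ[ℂ] sections X fr k where
  toFun s := ⟨fun e z ↦ (s.1 e z).compContinuousLinearMap (T.toFun e z), by
    obtain ⟨h1, h2, h3⟩ := s.2
    refine ⟨fun e z hz ↦ ?_, fun e ↦ ?_, fun e e' z hz ↦ ?_⟩
    · beta_reduce
      rw [h1 e z hz]
      rfl
    · exact contDiffOn_compContinuousLinearMap (h2 e) (T.contDiffOn e)
    · beta_reduce
      rw [h3 e e' z hz]
      ext v
      exact congrArg _ (funext fun i ↦ (T.comm e e' z hz (v i)).symm)⟩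
  map_add' s t := rfl
  map_smul' a s := rfl

theorem pullback_apply (T : BundleMap fr fr') {k : ℕ} (s : sections X fr' k)
    (e : atlas (Coord n) X) (z : Coord n) (v : Fin k → W) :
    (pullback T k s).1 e z v = s.1 e z fun i ↦ T.toFun e z (v i) := rfl

end BundleMaps

/-! ### Decomposition into pure types -/

section Types

variable {n k : ℕ} {X : Type*} [TopologicalSpace X] [ChartedSpace (Coord n) X]
  {P : Type*} [NormedAddCommGroup P] [NormedSpace ℂ P]

theorem ext_piecewise {Q : Type*} [NormedAddCommGroup Q] [NormedSpace ℂ Q]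
    {σ τ : (P × Q) [⋀^Fin k]→L[ℂ] ℂ}
    (h : ∀ (S : Finset (Fin k)) (x : Fin k → P) (w : Fin k → Q),
      σ (S.piecewise (fun i ↦ (x i, 0)) fun i ↦ (0, w i)) =
        τ (S.piecewise (fun i ↦ (x i, 0)) fun i ↦ (0, w i))) : σ = τ := by
  ext v
  have hv : v = (fun i ↦ ((v i).1, 0)) + fun i ↦ (0, (v i).2) := by
    funext i
    simp
  rw [hv, σ.map_add_univ, τ.map_add_univ]
  exact Finset.sum_congr rfl fun S _ ↦ h S _ _

variable {fr : OpenPartialHomeomorph X (Coord n) → OpenPartialHomeomorph X (Coord n) →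
      Coord n → P × Coord n →L[ℂ] P × Coord n}

/-- The transition functions preserve the two summands of the fibre. -/
def PreservesSummands (fr : OpenPartialHomeomorph X (Coord n) →
      OpenPartialHomeomorph X (Coord n) → Coord n → P × Coord n →L[ℂ] P × Coord n) : Prop :=
  ∀ e e' z, ∃ (A : P →L[ℂ] P) (B : Coord n →L[ℂ] Coord n), fr e e' z = A.prodMap B

theorem preservesSummands_formFrame :
    PreservesSummands (formFrame (n := n) (X := X)) := fun _ _ _ ↦ ⟨_, _, rfl⟩

theorem preservesSummands_polyFrame :
    PreservesSummands (polyFrame (n := n) (X := X)) := fun _ _ _ ↦ ⟨_, _, rfl⟩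

/-- Multiplication by `t` on the first summand.  The pullback along it multiplies the part of type
`(p, q)` by `t ^ p`. -/
def scaling (hfr : PreservesSummands fr) (t : ℂ) : BundleMap fr fr where
  toFun _ _ := (t • ContinuousLinearMap.id ℂ P).prodMap (.id ℂ (Coord n))
  contDiffOn _ := contDiffOn_const
  comm e e' z _ a := by
    obtain ⟨A, B, h⟩ := hfr e e' z
    rw [h]
    exact Prod.ext (map_smul A t a.1).symm rfl

theorem pullback_scaling_piecewise (hfr : PreservesSummands fr) (t : ℂ) (s : sections X fr k)
    (e : atlas (Coord n) X) (z : Coord n) (S : Finset (Fin k)) (x : Fin k → P)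
    (w : Fin k → Coord n) :
    (pullback (scaling hfr t) k s).1 e z (S.piecewise (fun i ↦ (x i, 0)) fun i ↦ (0, w i)) =
      t ^ S.card * s.1 e z (S.piecewise (fun i ↦ (x i, 0)) fun i ↦ (0, w i)) := by
  have h := (s.1 e z).map_piecewise_smul (fun _ ↦ t)
    (S.piecewise (fun i ↦ (x i, (0 : Coord n))) fun i ↦ ((0 : P), w i)) S
  rw [Finset.prod_const, smul_eq_mul] at h
  rw [← h, pullback_apply]
  refine congrArg _ (funext fun i ↦ ?_)
  by_cases hi : i ∈ S <;> simp [hi, scaling]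

/-- The part of type `(p, k - p)` of a section.  It is a linear combination of the pullbacks along
the scalings by `0, …, k`, with coefficients from the inverse of the Vandermonde matrix, and
therefore a smooth section. -/
def typePart (hfr : PreservesSummands fr) (p : Fin (k + 1)) (s : sections X fr k) :
    sections X fr k :=
  ∑ j : Fin (k + 1), (Matrix.vandermonde fun j : Fin (k + 1) ↦ (j : ℂ))⁻¹ p j •
    pullback (scaling hfr j) k s

theorem sections_sum_apply {ι : Type*} {W : Type*} [NormedAddCommGroup W] [NormedSpace ℂ W]
    {fr : OpenPartialHomeomorph X (Coord n) → OpenPartialHomeomorph X (Coord n) →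
      Coord n → W →L[ℂ] W} (J : Finset ι) (s : ι → sections X fr k)
    (e : atlas (Coord n) X) (z : Coord n) (v : Fin k → W) :
    (∑ j ∈ J, s j).1 e z v = ∑ j ∈ J, (s j).1 e z v := by
  let L : sections X fr k →+ ℂ :=
    { toFun := fun s ↦ s.1 e z v
      map_zero' := rfl
      map_add' := fun _ _ ↦ rfl }
  exact map_sum L s J

theorem typePart_piecewise (hfr : PreservesSummands fr) (p : Fin (k + 1)) (s : sections X fr k)
    (e : atlas (Coord n) X) (z : Coord n) (S : Finset (Fin k)) (x : Fin k → P)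
    (w : Fin k → Coord n) :
    (typePart hfr p s).1 e z (S.piecewise (fun i ↦ (x i, 0)) fun i ↦ (0, w i)) =
      if (p : ℕ) = S.card then s.1 e z (S.piecewise (fun i ↦ (x i, 0)) fun i ↦ (0, w i))
      else 0 := by
  set V := Matrix.vandermonde fun j : Fin (k + 1) ↦ (j : ℂ) with hV
  have hdet : IsUnit V.det := by
    refine isUnit_iff_ne_zero.2 (Matrix.det_vandermonde_ne_zero_iff.2 fun i j h ↦ ?_)
    exact Fin.ext (by exact_mod_cast h)
  have hS : S.card < k + 1 := Nat.lt_succ_of_le (by simpa using S.card_le_univ)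
  have h1 : ∑ j, V⁻¹ p j * (j : ℂ) ^ S.card = if (p : ℕ) = S.card then 1 else 0 := by
    have h := congrFun (congrFun (Matrix.nonsing_inv_mul V hdet) p) ⟨S.card, hS⟩
    simpa [Matrix.mul_apply, hV, Matrix.vandermonde_apply, Matrix.one_apply, Fin.ext_iff] using h
  have h2 (j : Fin (k + 1)) : (V⁻¹ p j • pullback (scaling hfr j) k s).1 e z
      (S.piecewise (fun i ↦ (x i, 0)) fun i ↦ (0, w i)) = V⁻¹ p j * (j : ℂ) ^ S.card *
        s.1 e z (S.piecewise (fun i ↦ (x i, 0)) fun i ↦ (0, w i)) := by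
    rw [mul_assoc, ← pullback_scaling_piecewise hfr]
    rfl
  rw [typePart, sections_sum_apply, Finset.sum_congr rfl fun j _ ↦ h2 j, ← Finset.sum_mul, h1]
  split_ifs <;> simp

theorem typePart_mem (hfr : PreservesSummands fr) (p : Fin (k + 1)) (s : sections X fr k) :
    typePart hfr p s ∈ pureType fr p k := by
  intro e z S x w h
  rw [typePart_piecewise, if_neg (Ne.symm h)]

theorem sum_typePart (hfr : PreservesSummands fr) (s : sections X fr k) :
    ∑ p, typePart hfr p s = s := by
  refine Subtype.ext (funext fun e ↦ funext fun z ↦ ext_piecewise fun S x w ↦ ?_)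
  have hS : S.card < k + 1 := Nat.lt_succ_of_le (by simpa using S.card_le_univ)
  rw [sections_sum_apply, Finset.sum_congr rfl fun p _ ↦ typePart_piecewise hfr p s e z S x w,
    Finset.sum_eq_single ⟨S.card, hS⟩]
  · simp
  · intro p _ hp
    exact if_neg fun h ↦ hp (Fin.ext h)
  · simp

/-! ### The filtration by the first degree -/

theorem filtration_antitone : Antitone fun p ↦ filtration fr p k := fun p p' h ↦
  iSup_mono fun _ ↦ iSup_mono' fun h' ↦ ⟨h.trans h', le_rfl⟩

theorem typePart_mem_filtration (hfr : PreservesSummands fr) {p : ℤ} {p' : Fin (k + 1)}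
    (h : p ≤ (p' : ℕ)) (s : sections X fr k) : typePart hfr p' s ∈ filtration fr p k :=
  Submodule.mem_iSup_of_mem (p' : ℕ) (Submodule.mem_iSup_of_mem h (typePart_mem hfr p' s))

theorem mem_filtration_of_nonpos (hfr : PreservesSummands fr) {p : ℤ} (hp : p ≤ 0)
    (s : sections X fr k) : s ∈ filtration fr p k := by
  rw [← sum_typePart hfr s]
  exact sum_mem fun p' _ ↦ typePart_mem_filtration hfr (hp.trans (by positivity)) s

/-- The subspace `F^1` consists of the sections whose restriction to the second summand vanishes. -/
theorem mem_filtration_one_iff (hfr : PreservesSummands fr) (s : sections X fr k) :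
    s ∈ filtration fr 1 k ↔
      ∀ e z, (s.1 e z).compContinuousLinearMap (.inr ℂ P (Coord n)) = 0 := by
  constructor
  · intro hs
    let N : Submodule ℂ (sections X fr k) :=
      { carrier := {s | ∀ e z, (s.1 e z).compContinuousLinearMap (.inr ℂ P (Coord n)) = 0}
        zero_mem' := fun _ _ ↦ rfl
        add_mem' := fun {s t} hs ht e z ↦ by
          change (s.1 e z).compContinuousLinearMap _ + (t.1 e z).compContinuousLinearMap _ = 0
          rw [hs, ht, add_zero]
        smul_mem' := fun a s hs e z ↦ by
          change a • (s.1 e z).compContinuousLinearMap _ = 0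
          rw [hs, smul_zero] }
    have hN : filtration fr 1 k ≤ N := by
      refine iSup₂_le fun p hp s hs e z ↦ ?_
      ext w
      have h := hs e z ∅ 0 w (by rw [Finset.card_empty]; lia)
      rwa [Finset.piecewise_empty] at h
    exact hN hs
  · intro hs
    have h0 : typePart hfr 0 s = 0 := by
      refine Subtype.ext (funext fun e ↦ funext fun z ↦ ext_piecewise fun S x w ↦ ?_)
      rw [typePart_piecewise]
      split_ifs with h
      · obtain rfl : S = ∅ := Finset.card_eq_zero.1 h.symm
        rw [Finset.piecewise_empty]
        exact congrArg (fun σ ↦ σ w) (hs e z)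
      · rfl
    rw [← sum_typePart hfr s, Fin.sum_univ_succ, h0, zero_add]
    exact sum_mem fun p' _ ↦ typePart_mem_filtration hfr (by simp) s

theorem filtration_eq_bot [FiniteDimensional ℂ P] {p : ℤ} (hp : (Module.finrank ℂ P : ℤ) < p) :
    filtration fr p k = ⊥ := by
  refine eq_bot_iff.2 (iSup₂_le fun p' hp' s hs ↦ ?_)
  refine Subtype.ext (funext fun e ↦ funext fun z ↦ ext_piecewise fun S x w ↦ ?_)
  by_cases hS : S.card = p'
  · refine (s.1 e z).toAlternatingMap.map_linearDependent _ fun hli ↦ ?_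
    -- the entries at the places in `S` lie in the first summand, and are too many
    have h1 : LinearIndependent ℂ fun i : S ↦ x i := by
      have h2 := hli.comp ((↑) : S → Fin k) Subtype.val_injective
      have h3 : (S.piecewise (fun i ↦ (x i, (0 : Coord n))) fun i ↦ ((0 : P), w i)) ∘
          ((↑) : S → Fin k) = LinearMap.inl ℂ P (Coord n) ∘ fun i : S ↦ x i := by
        funext i
        simp
      rw [h3] at h2
      exact h2.of_comp _
    have h4 := h1.fintype_card_le_finrank
    rw [Fintype.card_coe] at h4
    lia
  · exact hs e z S x w hS

end Types

/-! ### The anchor of the Poisson Lie algebroid and its pullback -/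

section Anchor

variable {n k : ℕ} {X : Type*} [TopologicalSpace X] [ChartedSpace (Coord n) X]
  [IsManifold 𝓘(ℂ, Coord n) ω X]

theorem exteriorD_apply (s : Forms n X k) (e : atlas (Coord n) X) {z : Coord n}
    (hz : z ∈ e.1.target) : (exteriorD k s).1 e z = connD (.id ℂ _) 0 (s.1 e) z := by
  change e.1.target.indicator (delLocal (s.1 e)) z +
    e.1.target.indicator (dbarLocal (s.1 e)) z = _
  rw [Set.indicator_of_mem hz, Set.indicator_of_mem hz, delLocal_eq, dbarLocal_eq, connD_nabla,
    connD_nabla, connD_nabla, ← map_add]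
  congr 1
  refine ContinuousLinearMap.ext fun a ↦ ?_
  rw [_root_.add_apply, nabla_apply, nabla_apply, nabla_apply]
  simp only [_root_.zero_apply, map_zero, smul_zero, sub_zero, ← map_add]
  simp

theorem totalD_apply (Λ : PoissonStructure n X) (s : Polyvectors n X k) (e : atlas (Coord n) X)
    {z : Coord n} (hz : z ∈ e.1.target) : (totalD Λ k s).1 e z =
      connD (anchorP (Λ.bivector.1 e z)) (brackL n (cplx (fderiv ℝ (Λ.bivector.1 e) z)))
        (s.1 e) z := by
  change e.1.target.indicator (dbarLocal (s.1 e)) z +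
    e.1.target.indicator (schoutenLocal (Λ.bivector.1 e) (s.1 e)) z = _
  rw [Set.indicator_of_mem hz, Set.indicator_of_mem hz]
  exact dbar_add_schouten ((section_diff Λ.bivector hz).differentiableAt (by simp)) _

/-- The anchor of the Lie algebroid `T^{*(1,0)} ⊕ T^{0,1}`, the bundle map
`Λ^♯ ⊕ id : T^{*(1,0)} ⊕ T^{0,1} → T^{1,0} ⊕ T^{0,1}`. -/
def anchor (Λ : PoissonStructure n X) : BundleMap (X := X) (n := n) polyFrame formFrame where
  toFun e z := anchorP (Λ.bivector.1 e z)
  contDiffOn e :=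
    (linear_contDiff ((ContinuousLinearMap.compL ℂ (Lbar n) (Coord n) (Coord n × Coord n)
      (ContinuousLinearMap.inl ℂ _ _)).comp (sharpL n)) (Λ.bivector.2.2.1 e)).add contDiffOn_const
  comm e e' z hz a := by
    rw [anchorP_apply, anchorP_apply,
      sharp_pullback e.2 e'.2 hz (Λ.bivector.2.2.2 e e' z hz)]
    rfl

/-- The bundle map `T^{1,0} ⊕ T^{0,1} → T^{*(1,0)} ⊕ T^{0,1}` which is zero on the first summand and
the identity on the second. -/
def antiholomorphicPart : BundleMap (X := X) (n := n) formFrame polyFrame where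
  toFun _ _ := (ContinuousLinearMap.inr ℂ _ _).comp (ContinuousLinearMap.snd ℂ _ _)
  contDiffOn _ := contDiffOn_const
  comm e e' z hz a := by simp [formFrame, polyFrame]

theorem anchorP_inr (σ : Biv n) (w : Coord n) : anchorP σ (0, w) = (0, w) := by
  rw [anchorP_apply]
  simp [sharpL, ddz_apply]

theorem bivector_equations (Λ : PoissonStructure n X) (e : atlas (Coord n) X) {z : Coord n}
    (hz : z ∈ e.1.target) :
    dbarLocal (Λ.bivector.1 e) z = 0 ∧ schoutenLocal (Λ.bivector.1 e) (Λ.bivector.1 e) z = 0 :=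
  ⟨(Set.indicator_of_mem hz _).symm.trans (congrArg (fun t ↦ t.1 e z) Λ.holomorphic),
    (Set.indicator_of_mem hz _).symm.trans (congrArg (fun t ↦ t.1 e z) Λ.schouten_self)⟩

/-- The pullback along the anchor is a morphism from the complex of differential forms to the
complex of polyvector fields. -/
theorem totalD_pullback_anchor (Λ : PoissonStructure n X) (s : Forms n X k) :
    totalD Λ k (pullback (anchor Λ) k s) = pullback (anchor Λ) (k + 1) (exteriorD k s) := by
  refine Subtype.ext (funext fun e ↦ funext fun z ↦ ?_)
  by_cases hz : z ∈ e.1.target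
  · have hd : DifferentiableAt ℝ (Λ.bivector.1 e) z :=
      (section_diff Λ.bivector hz).differentiableAt (by simp)
    obtain ⟨hhol, hpois⟩ := bivector_equations Λ e hz
    -- `Λ^♯ ⊕ id` intertwines the brackets, as `Λ` is holomorphic and `[Λ, Λ] = 0`
    have hA := abstract_anchor (Λ := Λ.bivector.1 e) (e := dzLbar)
      (sn := .snd ℂ (Coord n →L[ℂ] ℂ) (Coord n))
      (R := fun y ↦ anchorP (Λ.bivector.1 e y)) sharpL_coord brackL_fst brackL_snd lamL_sharp
      lamL_anti (fun _ ↦ rfl) hd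
      (fun w a b ↦ by rw [dbar_biv hhol w]; rfl) (fun a b d ↦ schouten_biv hd hpois a b d)
    rw [totalD_apply Λ _ e hz]
    have h := connD_pullback (f := id) (T := fun y ↦ anchorP (Λ.bivector.1 e y)) (σ := s.1 e)
      (R := anchorP (Λ.bivector.1 e z)) (R' := .id ℂ _)
      (c := brackL n (cplx (fderiv ℝ (Λ.bivector.1 e) z))) (c' := 0)
      ((section_diff s hz).differentiableAt (by simp)) differentiableAt_id hA.1
      (fun a ↦ by
        rw [fderiv_id]
        refine Prod.ext rfl ?_
        simp)
      (brackL_anti _) (by simp) (fun a b ↦ by rw [hA.2 a b]; simp)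
    refine Eq.trans h ?_
    change (connD (.id ℂ _) 0 (s.1 e) z).compContinuousLinearMap _ =
      ((exteriorD k s).1 e z).compContinuousLinearMap _
    rw [exteriorD_apply s e hz]
    rfl
  · rw [(totalD Λ k (pullback (anchor Λ) k s)).2.1 e z hz,
      (pullback (anchor Λ) (k + 1) (exteriorD k s)).2.1 e z hz]

/-! ### Restriction to antiholomorphic tangent vectors -/

/-- On antiholomorphic tangent vectors `d s` depends only on the restriction of `s` to them.  By
`totalD_restrict` the same operator computes the restriction of `D s`. -/
theorem exteriorD_restrict (s : Forms n X k) (e : atlas (Coord n) X) {z : Coord n}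
    (hz : z ∈ e.1.target) :
    ((exteriorD k s).1 e z).compContinuousLinearMap (.inr ℂ (Coord n) (Coord n)) =
      connD (.inr ℂ _ _) 0
        (fun y ↦ (s.1 e y).compContinuousLinearMap (.inr ℂ (Coord n) (Coord n))) z := by
  rw [exteriorD_apply s e hz]
  refine (connD_pullback (f := id) (T := fun _ ↦ .inr ℂ (Coord n) (Coord n))
    ((section_diff s hz).differentiableAt (by simp)) differentiableAt_id
    (differentiableAt_const _) (fun a ↦ ?_) (by simp) (by simp) fun a b ↦ ?_).symm
  · rw [fderiv_id]
    refine Prod.ext rfl ?_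
    simp
  · simp [cplx_apply]
    rfl

theorem totalD_restrict (Λ : PoissonStructure n X) (s : Polyvectors n X k) (e : atlas (Coord n) X)
    {z : Coord n} (hz : z ∈ e.1.target) :
    ((totalD Λ k s).1 e z).compContinuousLinearMap (.inr ℂ (Coord n →L[ℂ] ℂ) (Coord n)) =
      connD (.inr ℂ _ _) 0
        (fun y ↦ (s.1 e y).compContinuousLinearMap (.inr ℂ (Coord n →L[ℂ] ℂ) (Coord n))) z := by
  rw [totalD_apply Λ s e hz]
  refine (connD_pullback (f := id) (T := fun _ ↦ .inr ℂ (Coord n →L[ℂ] ℂ) (Coord n))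
    ((section_diff s hz).differentiableAt (by simp)) differentiableAt_id
    (differentiableAt_const _) (fun a ↦ ?_) (by simp) (brackL_anti _) fun a b ↦ ?_).symm
  · rw [fderiv_id]
    refine (anchorP_inr _ a).trans (Prod.ext rfl ?_)
    simp
  · simp [cplx_apply, brackL, ddz_apply]
    rfl

theorem exteriorD_mem_filtration_one (Λ : PoissonStructure n X) {s : Polyvectors n X k}
    (hs : totalD Λ k s ∈ filtration polyFrame 1 (k + 1)) :
    exteriorD k (pullback antiholomorphicPart k s) ∈ filtration formFrame 1 (k + 1) := by
  rw [mem_filtration_one_iff preservesSummands_polyFrame] at hs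
  refine (mem_filtration_one_iff preservesSummands_formFrame _).2 fun e z ↦ ?_
  by_cases hz : z ∈ e.1.target
  · rw [exteriorD_restrict _ e hz, ← hs e z, totalD_restrict Λ s e hz]
    rfl
  · rw [(exteriorD k (pullback antiholomorphicPart k s)).2.1 e z hz]
    rfl

theorem pullback_anchor_mem_filtration_one (Λ : PoissonStructure n X) {s : Forms n X k}
    (hs : s ∈ filtration formFrame 1 k) :
    pullback (anchor Λ) k s ∈ filtration polyFrame 1 k := by
  rw [mem_filtration_one_iff preservesSummands_formFrame] at hs
  refine (mem_filtration_one_iff preservesSummands_polyFrame _).2 fun e z ↦ ?_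
  rw [← hs e z]
  ext w
  exact congrArg _ (funext fun i ↦ anchorP_inr _ (w i))

theorem sub_pullback_mem_filtration_one (Λ : PoissonStructure n X) (s : Polyvectors n X k) :
    s - pullback (anchor Λ) k (pullback antiholomorphicPart k s) ∈ filtration polyFrame 1 k := by
  refine (mem_filtration_one_iff preservesSummands_polyFrame _).2 fun e z ↦ ?_
  ext w
  change s.1 e z (fun i ↦ (0, w i)) -
    s.1 e z (fun i ↦ (0, (anchorP (Λ.bivector.1 e z) (0, w i)).2)) = 0
  simp only [anchorP_inr, sub_self]

/-- A polyvector field whose differential lies in `F^1` differs from a closed one by an element of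
`F^1`. -/
theorem exists_mem_filtration_one_totalD_eq (Λ : PoissonStructure n X)
    (frolicher : DegeneratesAt (exteriorD (n := n) (X := X)) exteriorD_exteriorD
      (filtration formFrame) 1) {x : Polyvectors n X k}
    (hx : totalD Λ k x ∈ filtration polyFrame 1 (k + 1)) :
    ∃ x' ∈ filtration polyFrame 1 k, totalD Λ k x' = totalD Λ k x := by
  set φ : Forms n X k := pullback antiholomorphicPart k x with hφ
  obtain ⟨y, hy, hDy⟩ := frolicher.exists_sub_mem _ (fun k ↦ filtration_antitone) (p := 0)
    (mem_filtration_of_nonpos preservesSummands_formFrame le_rfl φ)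
    (exteriorD_mem_filtration_one Λ hx) n
  rw [filtration_eq_bot (by simp), Submodule.mem_bot] at hDy
  rw [zero_add] at hy
  refine ⟨x - pullback (anchor Λ) k (φ - y), ?_, ?_⟩
  · rw [map_sub, sub_sub_eq_add_sub, add_sub_right_comm]
    exact add_mem (sub_pullback_mem_filtration_one Λ x) (pullback_anchor_mem_filtration_one Λ hy)
  · rw [map_sub, totalD_pullback_anchor, hDy, map_zero, sub_zero]

end Anchor

theorem finrank_covectors (n : ℕ) : Module.finrank ℂ (Coord n →L[ℂ] ℂ) = n := by
  rw [← (LinearMap.toContinuousLinearMap (𝕜 := ℂ) (E := Coord n) (F' := ℂ)).finrank_eq,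
    Module.finrank_linearMap]
  simp

end HolomorphicPoisson

end

open scoped Manifold ContDiff in
open HolomorphicPoisson in
theorem theorem6 (n : ℕ) (X : Type*) [TopologicalSpace X] [ChartedSpace (Coord n) X]
    [IsManifold 𝓘(ℂ, Coord n) ω X] (Λ : PoissonStructure n X)
    (frolicher : DegeneratesAt (exteriorD (n := n) (X := X)) exteriorD_exteriorD
      (filtration formFrame) 1) :
    DegeneratesAt (totalD Λ) (totalD_totalD Λ) (filtration polyFrame) n := by
  intro r hr p k
  rw [pageDifferential_eq_zero_iff]
  intro x hx hDx
  rcases lt_trichotomy p 0 with hp | rfl | hp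
  · exact apply_mem_boundaries (mem_filtration_of_nonpos preservesSummands_polyFrame hp x) hDx
  · rcases Nat.eq_zero_or_pos r with rfl | hr0
    -- here `n = 0`, and there are no forms of positive degree
    · obtain rfl := Nat.le_zero.1 hr
      have h0 : totalD Λ k x = 0 := by
        refine Subtype.ext (funext fun e ↦ funext fun z ↦ ?_)
        ext v
        exact ((totalD Λ k x).1 e z).map_coord_zero 0 (Subsingleton.elim _ _)
      rw [h0]
      exact zero_mem _
    · obtain ⟨x', hx', h⟩ := exists_mem_filtration_one_totalD_eq Λ frolicher
        (filtration_antitone (by lia) hDx)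
      rw [← h] at hDx ⊢
      exact apply_mem_boundaries (by rwa [zero_add]) hDx
  · rw [filtration_eq_bot (by rw [finrank_covectors]; lia), Submodule.mem_bot] at hDx
    rw [hDx]
    exact zero_mem _
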